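/- **Parameters.** Let $(m_k)_{k\ge1},(n_k)_{k\ge1},(l_k)_{k\ge1}$ be strictly increasing sequences of natural numbers with $m_1=4$, $n_1=4$, $l_1=2$ and, for all $k\ge 2$, $$m_km_{k-1}\le m_1^{l_k},\qquad \Big(\frac{n_{k-1}}{m_{k-1}}\Big)^{l_k}\le\frac{n_k}{m_{k-1}m_k}.$$ For each $q$ let $\mathrm{Net}_{1,q}$ be a finite symmetric $\frac1{4n_q^2}$-net of $[-1,1]$ containing $\pm1$. **The ambient nodes.** Finite sets $\bar\Delta_q$, $\bar\Gamma_q=\bar\Delta_1\cup\dots\cup\bar\Delta_q$ and functionals $\bar c^*_\gamma$, $\bar d^*_\gamma=e^*_\gamma-\bar c^*_\gamma$ in $\ell_1$ ($e^*_\gamma$ the unit vectors) are defined recursively. $\bar\Delta_1=\{1\}$, $\bar c^*_1=0$. The elements are enumerated level after level, in an arbitrary order within each level; intervals and ranges are taken in this enumeration, and $\bar P^*_I$ is the projection onto $\langle\bar d^*_\gamma:\gamma\in I\rangle$ along the other $\bar d^*_\gamma$. The set $\bar\Delta_{q+1}$ consists of * the tuples $\gamma=(q+1,0,m_j,I,\epsilon,\lambda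 e^*_\eta)$ with $1\le j\le q$, $I\subset\bar\Gamma_q$ an interval, $\epsilon=\pm1$, $\lambda\in\mathrm{Net}_{1,q}$, $\eta\in\bar\Gamma_q$, $\bar P^*_I(\lambda e^*_\eta)\ne0$; here $\bar c^*_\gamma=\frac1{m_j}\epsilon\bar P^*_I(\lambda e^*_\eta)$ and $\mathrm{age}(\gamma)=1$; * the tuples $\gamma=(q+1,\xi,m_j,I,\epsilon,\lambda e^*_\eta)$ with $1\le j\le p<q$, $\xi\in\bar\Delta_p$, $w(\xi)=m_j^{-1}$, $\mathrm{age}(\xi)<n_j$, $I\subset\bar\Gamma_q\setminus\bar\Gamma_p$ an interval, $\epsilon=\pm1$, $\lambda\in\mathrm{Net}_{1,q}$, $\eta\in\bar\Gamma_q\setminus\bar\Gamma_p$, $\bar P^*_I(\lambda e^*_\eta)\ne0$; here $\bar c^*_\gamma=e^*_\xi+\frac1{m_j}\epsilon\bar P^*_I(\lambda e^*_\eta)$ and $\mathrm{age}(\gamma)=\mathrm{age}(\xi)+1$. In both cases the weight is $w(\gamma)=m_j^{-1}$ and the rank is $q+1$; the node $1$ has rank $1$ (it has no weight; put $w(1)=1$).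 Let $\bar\Gamma=\bigcup_q\bar\Gamma_q$, let $(\bar d_\gamma)$ be biorthogonal to $(\bar d^*_\gamma)$, regarded as bounded functions on $\bar\Gamma$ through $\bar d_\beta(\gamma)=e^*_\gamma(\bar d_\beta)$, and give their finite linear combinations the supremum norm on $\bar\Gamma$. The FDD support of $\sum_\beta x_\beta\bar d_\beta$ is the set of ranks of the $\beta$ with $x_\beta\neq0$. **Analyses.** For $\gamma\ne1$, following the second entries of the tuples back to a tuple with second entry $0$ gives nodes $\xi_1,\dots,\xi_a=\gamma$ with data $(I_i,\epsilon_i,\lambda_i,\eta_i)$ (the evaluation analysis); the bd-part of $e^*_\gamma$ is $\sum_i\bar d^*_{\xi_i}$ and the mt-part is $w(\gamma)\sum_i\epsilon_i\lambda_i\bar P^*_{I_i}e^*_{\eta_i}$. For $\gamma=1$ the bd-part is $\bar d^*_1$ and the mt-part is $0$ (empty evaluation analysis). Two nodes are neighbours if they occur at two different places in the bd-part of one $e^*_\gamma$, $\gamma\in\bar\Gamma$. The tree-analysis $(I_t,\epsilon_t,\eta_t)_{t\in\mathcal T}$ of $e^*_\gamma$ has root $(\bar\Gamma_{\mathrm{rank}\,\gamma},1,\gamma)$;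 the successors of $(I_t,\epsilon_t,\eta_t)$ are the $t^\frown i$ with entries $(I_i\cap I_t,\epsilon_i,\eta_i)$, where $(I_i,\epsilon_i,\lambda_i,\eta_i)_i$ comes from the evaluation analysis of $\eta_t$ and $i$ runs over the indices with $\bar P^*_{I_i\cap I_t}e^*_{\eta_i}\ne0$. Let $\mathrm{mtsupp}\,e^*_\gamma$ be the set of $\xi$ with $\bar P^*_{I_t}e^*_{\eta_t}=\bar d^*_\xi$ for a terminal $t$. Two nodes have compatible tree-analyses if these have the same tree and the same $I_t$ and, for each $t$, the nodes $\eta_t,\tilde\eta_t$ have the same weight, the same $\mathrm{mtsupp}$, the same rank, and the same set of ranks of the nodes in their bd-parts. **Special sequences.** Let $\mathcal Q$ be the set of finite nonempty sequences $(\zeta_i,\bar x_i)_{i\le k}$ with $\zeta_i\in\bar\Gamma$ and nonzero finite rational combinations $\bar x_i$ of the $\bar d_\gamma$, successive with respect to the FDD, and $\mathrm{rank}\,\zeta_i\ge\min\mathrm{supp}_{FDD}\bar x_i$. Let $\sigma:\mathcal Q\to\mathbb N$ be injective with $\sigma((\zeta_i,\bar x_i)_{i\le k})>w(\zeta_k)^{-1}\max\mathrm{supp}_{FDD}\,\bar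 x_k$. For $\gamma=(q+1,\xi,m_k,I,\epsilon,\lambda e^*_\eta)$, with $\xi$ a node or $0$, put $\lambda_{\gamma,x}=\epsilon e^*_\eta(x)$ if $e^*_\eta(x)\ne0$ and $\lambda_{\gamma,x}=\epsilon n_k^{-2}$ otherwise. A sequence $(\zeta_i,\bar x_i)_{i\le d}\in\mathcal Q$, $d\le n_{2j-1}$, is $j$-special if * $\zeta_1=(q_1+1,0,m_{2j-1},I_1,\epsilon_1,e^*_{\eta_1})$ and $\zeta_i=(q_i+1,\zeta_{i-1},m_{2j-1},I_i,\epsilon_i,\lambda_ie^*_{\eta_i})$ for $i\ge2$; * $w(\eta_1)=m_{4l-2}^{-1}<n_{2j-1}^{-2}$ for some $l\ge1$, and $w(\eta_i)=m_{4s_i}^{-1}$ for $i\ge2$, where $s_i=\sigma((\zeta_p,\bar x_p)_{p<i})$; * for odd $i$: $\lambda_i=1$ and $\|\bar x_i\|\le1$; * for even $i$: $\epsilon_i=1$; the mt-part of $e^*_{\eta_i}$ is $m_{4s_i}^{-1}\sum_{\beta\in B}\bar d^*_\beta$ and $\bar x_i=\frac{m_{4s_i}}{n_{4s_i}}\sum_{\beta\in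 B}\bar d_\beta$ for a set $B$ of $n_{4s_i}$ pairwise non-neighbour nodes; and $\lambda_i\in\mathrm{Net}_{1,q_i}$ satisfies $|\lambda_i-\lambda_{\zeta_{i-1},\bar x_{i-1}}|<\frac1{4n_{q_{i-1}}^2}$. Given $G\subset\bar\Gamma$, put $G_r=\{\gamma\in G:\mathrm{rank}\,\gamma\le r\}$. A $j$-special sequence is $(G,j)$-special if: for $d=1$, $\eta_1\in G_{q_1}$; for $d\ge2$, $\eta_d\in G_{q_d}\setminus G_{q_d-1}$, $\zeta_{d-1}\in G_{q_{d-1}+1}$ and $(\zeta_i,\bar x_i)_{i<d}$ is $(G_{q_{d-1}},j)$-special. **The set $\Gamma$.** Put $\Gamma_1=\bar\Delta_1$ and $\Gamma_{q+1}=\Gamma_q\cup\Delta^{reg}_{q+1}\cup\Delta^{sp}_{q+1}$, where: * $\Delta_{q+1}^{reg}$ consists of the nodes $(q+1,0,m_{2j},I,\epsilon,e^*_\eta)\in\bar\Delta_{q+1}$ with $\eta\in\Gamma_q$, and $(q+1,\xi,m_{2j},I,\epsilon,e^*_\eta)\in\bar\Delta_{q+1}$ with $\xi\in\Gamma_q$,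 $\mathrm{rank}\,\xi<q$ and $\eta\in\Gamma_q\setminus\Gamma_{\mathrm{rank}\,\xi}$, where $1\le j\le\lfloor (q+1)/2\rfloor$; * $\Delta_{q+1}^{sp}$ consists of the nodes of $\bar\Delta_{q+1}$ compatible with some $(\Gamma_q,j)$-special sequence, $1\le j\le\lfloor(q+1)/2\rfloor$. Compatibility is defined by recursion on the age. The node $(q+1,0,m_{2j-1},I,\epsilon,e^*_\eta)\in\bar\Delta_{q+1}$ is compatible with a $(\Gamma_q,j)$-special $(\zeta_1,\bar x_1)$, $\zeta_1=(q+1,0,m_{2j-1},I,\epsilon_1,e^*_{\eta_1})$, if $\eta\in\Gamma_q$ and $\eta,\eta_1$ have compatible tree-analyses. The node $\gamma=(q+1,\xi,m_{2j-1},I,\epsilon,\lambda e^*_\eta)\in\bar\Delta_{q+1}$ of age $a\ge2$ is compatible with a $(\Gamma_q,j)$-special $(\zeta_i,\bar x_i)_{i\le a}$, $\zeta_a=(q+1,\zeta_{a-1},m_{2j-1},I,\epsilon_a,\lambda_ae^*_{\eta_a})$, if $\eta,\xi\in\Gamma_q$, $\xi$ is compatible with $(\zeta_i,\bar x_i)_{i<a}$,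 and: if $a$ is odd, $\lambda=1$ and $\eta,\eta_a$ have compatible tree-analyses; if $a$ is even, $\epsilon=1$, $\eta=\eta_a$, $\lambda\in\mathrm{Net}_{1,q}$ and $|\lambda-\lambda_{\xi,\bar x_{a-1}}|<\frac1{4n_{\mathrm{rank}\,\xi}^2}$. Let $\Gamma=\bigcup_q\Gamma_q$, let $d_\beta=\bar d_\beta|_\Gamma\in\ell_\infty(\Gamma)$ for $\beta\in\Gamma$, and let $\mathfrak X_{Kus}$ be the closed linear span of $\{d_\beta:\beta\in\Gamma\}$ in the real space $\ell_\infty(\Gamma)$. Let $(\gamma_n)_n$ be the increasing enumeration of $\Gamma$. **Statement.** For every choice of the parameters, the sequence $(d_{\gamma_n})_n$ is a shrinking Schauder basis of $\mathfrak X_{Kus}$ (that is, its biorthogonal functionals form a Schauder basis of $\mathfrak X_{Kus}^*$), and the dual space $\mathfrak X_{Kus}^*$ is isomorphic, as a Banach space, to $\ell_1(\Gamma)$. -/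

import Mathlib

noncomputable section

namespace Kus

/-! ## Nodes -/

/-- Raw nodes.  `init` is the unique element of the first level.  Writing `I` for the interval of
nodes from `a` to `b`, `start q j a b ε lam η` is the tuple `(q+1, 0, m_j, I, ε, lam • e*_η)` and
`step q ξ j a b ε lam η` is the tuple `(q+1, ξ, m_j, I, ε, lam • e*_η)`.
The constraints on these data are imposed in `Scheme.IsNode`. -/
inductive Node : Type
  | init : Node
  | start (q j : ℕ) (a b : Node) (ε : ℤˣ) (lam : ℝ) (η : Node) : Node
  | step (q : ℕ) (ξ : Node) (j : ℕ) (a b : Node) (ε : ℤˣ) (lam : ℝ) (η : Node) : Node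

namespace Node

/-- The rank of a node. -/
def rank : Node → ℕ
  | init => 1
  | start q _ _ _ _ _ _ => q + 1
  | step q _ _ _ _ _ _ _ => q + 1

@[simp] theorem rank_start (q j : ℕ) (a b : Node) (ε : ℤˣ) (lam : ℝ) (η : Node) :
    (start q j a b ε lam η).rank = q + 1 := rfl

@[simp] theorem rank_step (q : ℕ) (ξ : Node) (j : ℕ) (a b : Node) (ε : ℤˣ) (lam : ℝ) (η : Node) :
    (step q ξ j a b ε lam η).rank = q + 1 := rfl

/-- The age of a node (the initial node, which has no age, gets `0`). -/
def age : Node → ℕ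
  | init => 0
  | start _ _ _ _ _ _ _ => 1
  | step _ ξ _ _ _ _ _ _ => age ξ + 1

end Node

/-- Finitely supported functionals, written in the coordinates of the sequence `(d*_γ)`: the
finitely supported function `f` stands for `∑ f(β) d*_β`. -/
abbrev Functional : Type := Node →₀ ℝ

/-- Finitely supported vectors with rational coefficients: `x` stands for `∑ x(β) d_β`, where
`(d_β)` is biorthogonal to `(d*_β)`. -/
abbrev RatVec : Type := Node →₀ ℚ

/-- The value `f(x)`; by biorthogonality it is `∑ f(β) x(β)`. -/
def pairing (f : Functional) (x : RatVec) : ℝ := x.sum fun β c => f β * (c : ℝ)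

/-- The functional `d*_γ`. -/
def dStar (γ : Node) : Functional := Finsupp.single γ 1

open Classical in
/-- The projection `P*_I` onto the span of `d*_β`, `β ∈ I`. -/
def projStar (I : Set Node) (f : Functional) : Functional := f.filter (· ∈ I)

/-- The free choices of the construction: the sequences `(m_k)`, `(n_k)`, `(l_k)` (indexed by
`k ≥ 1`; the values at `0` play no role), the finite nets `Net_{1,q}`, and an enumeration of the
nodes.  The enumeration is recorded as a linear order in which nodes of smaller rank come first;
as the levels are finite, this is the same as enumerating the levels one after the other. -/
structure Scheme where
  m : ℕ → ℕ
  n : ℕ → ℕ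
  l : ℕ → ℕ
  m_strictMono : StrictMonoOn m (Set.Ici 1)
  n_strictMono : StrictMonoOn n (Set.Ici 1)
  l_strictMono : StrictMonoOn l (Set.Ici 1)
  m_one : m 1 = 4
  n_one : n 1 = 4
  l_one : l 1 = 2
  m_growth : ∀ k, 2 ≤ k → m k * m (k - 1) ≤ m 1 ^ l k
  n_growth : ∀ k, 2 ≤ k →
    ((n (k - 1) : ℝ) / m (k - 1)) ^ l k ≤ (n k : ℝ) / ((m (k - 1) : ℝ) * m k)
  net : ℕ → Finset ℝ
  net_subset : ∀ q, ∀ x ∈ net q, |x| ≤ 1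
  net_symm : ∀ q, ∀ x ∈ net q, -x ∈ net q
  one_mem_net : ∀ q, (1 : ℝ) ∈ net q
  net_dense : ∀ q, 1 ≤ q → ∀ x : ℝ, |x| ≤ 1 → ∃ y ∈ net q, |x - y| ≤ 1 / (4 * (n q : ℝ) ^ 2)
  ord : LinearOrder Node
  ord_rank : ∀ β γ : Node, β.rank < γ.rank → ord.lt β γ

namespace Scheme

variable (S : Scheme)

/-- The weight `w(γ) = m_j⁻¹`.  The initial node has no weight; it gets the value `1`, which is
different from all `m_j⁻¹`. -/
def weight : Node → ℝ
  | .init => 1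
  | .start _ j _ _ _ _ _ => (S.m j : ℝ)⁻¹
  | .step _ _ j _ _ _ _ _ => (S.m j : ℝ)⁻¹

/-- The interval of nodes from `a` to `b`. -/
def interval (a b : Node) : Set Node := {β | S.ord.le a β ∧ S.ord.le β b}

/-- The functional `e*_γ = d*_γ + c*_γ`, where `c*_γ` is `0` for the initial node,
`m_j⁻¹ ε P*_I b*` for `γ = (q+1, 0, m_j, I, ε, b*)` and `e*_ξ + m_j⁻¹ ε P*_I b*` for
`γ = (q+1, ξ, m_j, I, ε, b*)`. -/
def eStar : Node → Functional
  | .init => dStar .init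
  | .start q j a b ε lam η =>
      dStar (.start q j a b ε lam η)
        + ((S.m j : ℝ)⁻¹ * ((ε : ℤ) : ℝ)) • projStar (S.interval a b) (lam • eStar η)
  | .step q ξ j a b ε lam η =>
      dStar (.step q ξ j a b ε lam η)
        + (eStar ξ
          + ((S.m j : ℝ)⁻¹ * ((ε : ℤ) : ℝ)) • projStar (S.interval a b) (lam • eStar η))

/-! The functionals `e*_γ` form an algebraic basis of the space of finitely supported functionals;
so they can be identified with the unit vectors of `ℓ_1`, and the coordinates used above describe
the same functionals as coordinates with respect to `(e*_γ)`. -/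

theorem eStar_triangular (S : Scheme) (γ : Node) :
    S.eStar γ γ = 1 ∧ ∀ β, S.eStar γ β ≠ 0 → β = γ ∨ sizeOf β < sizeOf γ := by
  classical
  induction γ with
  | init =>
    refine ⟨by simp [eStar, dStar], fun β hβ => ?_⟩
    by_contra hne
    push Not at hne
    exact hβ (by simp [eStar, dStar, Ne.symm hne.1])
  | start q j a b ε lam η iha ihb ih =>
    have key : ∀ β, S.eStar η β ≠ 0 → sizeOf β < sizeOf (Node.start q j a b ε lam η) := by
      intro β hβ
      rcases ih.2 β hβ with h | h
      · subst h; simp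
      · simp; omega
    refine ⟨?_, fun β hβ => ?_⟩
    · have h0 : S.eStar η (.start q j a b ε lam η) = 0 := by
        by_contra h
        exact lt_irrefl _ (key _ h)
      simp [eStar, dStar, projStar, Finsupp.filter_apply, h0]
    · by_contra hne
      push Not at hne
      have h0 : S.eStar η β = 0 := by
        by_contra h
        exact absurd (key β h) (not_lt.2 hne.2)
      exact hβ (by simp [eStar, dStar, projStar, Finsupp.filter_apply, Ne.symm hne.1, h0])
  | step q ξ j a b ε lam η ihξ iha ihb ih =>
    have key : ∀ β, S.eStar η β ≠ 0 → sizeOf β < sizeOf (Node.step q ξ j a b ε lam η) := by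
      intro β hβ
      rcases ih.2 β hβ with h | h
      · subst h; simp
      · simp; omega
    have key' : ∀ β, S.eStar ξ β ≠ 0 → sizeOf β < sizeOf (Node.step q ξ j a b ε lam η) := by
      intro β hβ
      rcases ihξ.2 β hβ with h | h
      · subst h; simp; omega
      · simp; omega
    refine ⟨?_, fun β hβ => ?_⟩
    · have h0 : S.eStar η (.step q ξ j a b ε lam η) = 0 := by
        by_contra h
        exact lt_irrefl _ (key _ h)
      have h1 : S.eStar ξ (.step q ξ j a b ε lam η) = 0 := by
        by_contra h
        exact lt_irrefl _ (key' _ h)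
      simp [eStar, dStar, projStar, Finsupp.filter_apply, h0, h1]
    · by_contra hne
      push Not at hne
      have h0 : S.eStar η β = 0 := by
        by_contra h
        exact absurd (key β h) (not_lt.2 hne.2)
      have h1 : S.eStar ξ β = 0 := by
        by_contra h
        exact absurd (key' β h) (not_lt.2 hne.2)
      exact hβ (by simp [eStar, dStar, projStar, Finsupp.filter_apply, Ne.symm hne.1, h0, h1])

theorem linearIndependent_eStar (S : Scheme) : LinearIndependent ℝ S.eStar := by
  classical
  rw [linearIndependent_iff]
  intro f hf
  by_contra hne
  obtain ⟨γ, hγ, hmax⟩ := f.support.exists_max_image (fun γ => sizeOf γ)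
    (Finsupp.support_nonempty_iff.2 hne)
  have h := DFunLike.congr_fun hf γ
  rw [Finsupp.linearCombination_apply, Finsupp.sum, Finsupp.finsetSum_apply,
    Finset.sum_eq_single_of_mem γ hγ] at h
  · rw [Finsupp.smul_apply, (S.eStar_triangular γ).1] at h
    exact (Finsupp.mem_support_iff.1 hγ) (by simpa using h)
  · intro β hβ hβγ
    have h0 : S.eStar β γ = 0 := by
      by_contra h1
      rcases (S.eStar_triangular β).2 γ h1 with h2 | h2
      · exact hβγ h2.symm
      · exact absurd h2 (not_lt.2 (hmax β hβ))
    simp [h0]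

theorem span_eStar (S : Scheme) : Submodule.span ℝ (Set.range S.eStar) = ⊤ := by
  classical
  have key : ∀ k : ℕ, ∀ γ : Node, sizeOf γ ≤ k →
      dStar γ ∈ Submodule.span ℝ (Set.range S.eStar) := by
    intro k
    induction k with
    | zero => intro γ h; cases γ <;> simp at h
    | succ k ih =>
      intro γ hγ
      have h1 : dStar γ = S.eStar γ - ((S.eStar γ).erase γ).sum fun β c => c • dStar β := by
        have h2 : (((S.eStar γ).erase γ).sum fun β c => c • dStar β) = (S.eStar γ).erase γ := by
          simp only [dStar, Finsupp.smul_single, smul_eq_mul, mul_one]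
          exact Finsupp.sum_single _
        rw [h2, eq_sub_iff_add_eq, dStar]
        have h3 := Finsupp.single_add_erase γ (S.eStar γ)
        rwa [(S.eStar_triangular γ).1] at h3
      rw [h1]
      refine Submodule.sub_mem _ (Submodule.subset_span ⟨γ, rfl⟩) ?_
      refine Submodule.sum_mem _ fun β hβ => Submodule.smul_mem _ _ (ih β ?_)
      rw [Finsupp.support_erase, Finset.mem_erase, Finsupp.mem_support_iff] at hβ
      rcases (S.eStar_triangular γ).2 β hβ.2 with h | h
      · exact absurd h hβ.1
      · omega
  rw [eq_top_iff]
  intro f _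
  rw [← Finsupp.sum_single f]
  refine Submodule.sum_mem _ fun β _ => ?_
  have := Submodule.smul_mem _ (f β) (key _ β le_rfl)
  simpa [dStar] using this

/-- `S.IsNode γ` says that `γ` belongs to the set of nodes of the ambient space.  The nodes of
rank `q` form the level `q`. -/
inductive IsNode : Node → Prop
  | init : IsNode .init
  | start {q j : ℕ} {a b : Node} {ε : ℤˣ} {lam : ℝ} {η : Node}
      (hj : 1 ≤ j) (hjq : j ≤ q)
      (ha : IsNode a) (hb : IsNode b) (hab : S.ord.le a b) (hbq : b.rank ≤ q)
      (hlam : lam ∈ S.net q) (hη : IsNode η) (hηq : η.rank ≤ q)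
      (hP : projStar (S.interval a b) (lam • S.eStar η) ≠ 0) :
      IsNode (.start q j a b ε lam η)
  | step {q p j : ℕ} {ξ a b : Node} {ε : ℤˣ} {lam : ℝ} {η : Node}
      (hpq : p < q) (hj : 1 ≤ j) (hjp : j ≤ p)
      (hξ : IsNode ξ) (hξp : ξ.rank = p) (hξw : S.weight ξ = (S.m j : ℝ)⁻¹) (hξa : ξ.age < S.n j)
      (ha : IsNode a) (hb : IsNode b) (hab : S.ord.le a b) (hpa : p < a.rank) (hbq : b.rank ≤ q)
      (hlam : lam ∈ S.net q) (hη : IsNode η) (hpη : p < η.rank) (hηq : η.rank ≤ q)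
      (hP : projStar (S.interval a b) (lam • S.eStar η) ≠ 0) :
      IsNode (.step q ξ j a b ε lam η)

/-! ## Analyses of nodes -/

/-- One entry `(I_i, ε_i, λ_i e*_{η_i}, ξ_i)` of an evaluation analysis. -/
structure EvalEntry where
  I : Set Node
  ε : ℤˣ
  lam : ℝ
  η : Node
  ξ : Node

/-- The evaluation analysis of a node (empty for the initial node). -/
def evalAnalysis : Node → List EvalEntry
  | .init => []
  | .start q j a b ε lam η => [⟨S.interval a b, ε, lam, η, .start q j a b ε lam η⟩]
  | .step q ξ j a b ε lam η =>
      evalAnalysis ξ ++ [⟨S.interval a b, ε, lam, η, .step q ξ j a b ε lam η⟩]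

/-- The nodes `ξ_1, …, ξ_a` of the bd-part `∑ d*_{ξ_i}` of `e*_γ` (for the initial node
`e*_γ = d*_γ`). -/
def bdNodes : Node → List Node
  | .init => [.init]
  | γ => (S.evalAnalysis γ).map EvalEntry.ξ

/-- The mt-part `w(γ) ∑ ε_i λ_i P*_{I_i} e*_{η_i}` of `e*_γ`. -/
def mtPart (γ : Node) : Functional :=
  S.weight γ • ((S.evalAnalysis γ).map fun s =>
    (((s.ε : ℤ) : ℝ) * s.lam) • projStar s.I (S.eStar s.η)).sum

/-- A triple `(I_t, ε_t, η_t)` of a tree-analysis. -/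
structure TreeEntry where
  I : Set Node
  ε : ℤˣ
  η : Node

open Classical in
/-- The `i`-th immediate successor of an entry `(I, ε, η)` of a tree-analysis, which exists when
the evaluation analysis of `η` has an `i`-th entry and `P*_{I_i ∩ I} e*_{η_i} ≠ 0`. -/
def child (t : TreeEntry) (i : ℕ) : Option TreeEntry :=
  match (S.evalAnalysis t.η)[i]? with
  | none => none
  | some s =>
      if projStar (s.I ∩ t.I) (S.eStar s.η) ≠ 0 then some ⟨s.I ∩ t.I, s.ε, s.η⟩ else none

/-- The tree-analysis of `e*_γ`, as a partial function on finite sequences of natural numbers; its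
domain is the tree of the analysis and the empty sequence is the root. -/
def treeAnalysis (γ : Node) (t : List ℕ) : Option TreeEntry :=
  t.foldlM S.child ⟨{β | β.rank ≤ γ.rank}, 1, γ⟩

/-- The set `mtsupp e*_γ`: all `ξ` with `P*_{I_t} e*_{η_t} = d*_ξ` for a terminal `t`. -/
def mtSupp (γ : Node) : Set Node :=
  {ξ | ∃ (t : List ℕ) (s : TreeEntry), S.treeAnalysis γ t = some s ∧
    (∀ i, S.treeAnalysis γ (t ++ [i]) = none) ∧ projStar s.I (S.eStar s.η) = dStar ξ}

/-- The set of the ranks of the nodes in the bd-part of `e*_γ`. -/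
def bdRanks (γ : Node) : Set ℕ := {r | ∃ ξ ∈ S.bdNodes γ, ξ.rank = r}

/-- Compatible tree-analyses. -/
def CompatibleTrees (γ γ' : Node) : Prop :=
  ∀ t : List ℕ, ((S.treeAnalysis γ t).isSome ↔ (S.treeAnalysis γ' t).isSome) ∧
    ∀ s s', S.treeAnalysis γ t = some s → S.treeAnalysis γ' t = some s' →
      s.I = s'.I ∧
      S.weight s.η = S.weight s'.η ∧
      S.mtSupp s.η = S.mtSupp s'.η ∧
      s.η.rank = s'.η.rank ∧
      S.bdRanks s.η = S.bdRanks s'.η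

/-- Neighbour nodes: both occur, at different places, in the bd-part of a common `e*_γ`. -/
def Neighbours (ξ₁ ξ₂ : Node) : Prop :=
  ∃ γ, S.IsNode γ ∧ ∃ i j : ℕ, i < j ∧ (S.bdNodes γ)[i]? = some ξ₁ ∧ (S.bdNodes γ)[j]? = some ξ₂

/-! ## Special sequences -/

/-- The number `λ_{γ,x}`, for `γ = (q+1, ξ, m_k, I, ε, e*_η)`: it is `ε e*_η(x)` if
`e*_η(x) ≠ 0`, and `ε n_k⁻²` otherwise. -/
def lamOf (γ : Node) (x : RatVec) : ℝ :=
  open Classical in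
  match γ with
  | .init => 0
  | .start _ k _ _ ε _ η | .step _ _ k _ _ ε _ η =>
      if pairing (S.eStar η) x ≠ 0 then ((ε : ℤ) : ℝ) * pairing (S.eStar η) x
      else ((ε : ℤ) : ℝ) * ((S.n k : ℝ) ^ 2)⁻¹

/-- The set `𝒬` of finite sequences of pairs `(ζ_i, x_i)`, where `ζ_i` is a node with
`rank ζ_i ≥ min ran_FDD x_i` and the `x_i` are nonzero vectors, finitely supported on nodes, with
rational coefficients and successive with respect to the FDD (whose `q`-th summand is spanned by
the `d_β` with `rank β = q`). -/
def sequences : Set (List (Node × RatVec)) :=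
  {s | s ≠ [] ∧
    (∀ p ∈ s, S.IsNode p.1 ∧ p.2 ≠ 0 ∧ (∀ β ∈ p.2.support, S.IsNode β) ∧
      ∃ β ∈ p.2.support, β.rank ≤ p.1.rank) ∧
    s.Pairwise fun p p' => ∀ β ∈ p.2.support, ∀ β' ∈ p'.2.support, β.rank < β'.rank}

/-- A coding function: injective on `𝒬`, with
`σ((ζ_1,x_1),…,(ζ_k,x_k)) > w(ζ_k)⁻¹ max supp_FDD x_k`. -/
structure Coding where
  σ : List (Node × RatVec) → ℕ
  injOn : Set.InjOn σ S.sequences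
  growth : ∀ s ∈ S.sequences, ∀ p, s.getLast? = some p →
    ∀ β ∈ p.2.support, (S.weight p.1)⁻¹ * (β.rank : ℝ) < (σ s : ℝ)

variable {S}

namespace Coding

variable (C : Coding S)

/-- `C.IsSpecial j s` says that `s` is a `j`-special sequence. -/
inductive IsSpecial (j : ℕ) : List (Node × RatVec) → Prop
  | first {q : ℕ} {a b : Node} {ε : ℤˣ} {η : Node} {x : RatVec} {i : ℕ}
      (hQ : [(Node.start q (2 * j - 1) a b ε 1 η, x)] ∈ S.sequences)
      (hlen : 1 ≤ S.n (2 * j - 1))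
      (hi : 1 ≤ i) (hw : S.weight η = (S.m (4 * i - 2) : ℝ)⁻¹)
      (hw' : S.weight η < ((S.n (2 * j - 1) : ℝ) ^ 2)⁻¹)
      (hx : ∀ γ, S.IsNode γ → |pairing (S.eStar γ) x| ≤ 1) :
      IsSpecial j [(.start q (2 * j - 1) a b ε 1 η, x)]
  | odd {s : List (Node × RatVec)} {ζ : Node} {y : RatVec}
      {q : ℕ} {a b : Node} {ε : ℤˣ} {η : Node} {x : RatVec}
      (hs : IsSpecial j (s ++ [(ζ, y)]))
      (hQ : s ++ [(ζ, y)] ++ [(Node.step q ζ (2 * j - 1) a b ε 1 η, x)] ∈ S.sequences)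
      (hlen : s.length + 2 ≤ S.n (2 * j - 1)) (hodd : Odd (s.length + 2))
      (hw : S.weight η = (S.m (4 * C.σ (s ++ [(ζ, y)])) : ℝ)⁻¹)
      (hx : ∀ γ, S.IsNode γ → |pairing (S.eStar γ) x| ≤ 1) :
      IsSpecial j (s ++ [(ζ, y)] ++ [(.step q ζ (2 * j - 1) a b ε 1 η, x)])
  | even {s : List (Node × RatVec)} {ζ : Node} {y : RatVec}
      {q k : ℕ} {a b : Node} {lam : ℝ} {η : Node} {x : RatVec} {B : Finset Node}
      (hs : IsSpecial j (s ++ [(ζ, y)]))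
      (hQ : s ++ [(ζ, y)] ++ [(Node.step q ζ (2 * j - 1) a b 1 lam η, x)] ∈ S.sequences)
      (hlen : s.length + 2 ≤ S.n (2 * j - 1)) (heven : Even (s.length + 2))
      (hk : k = 4 * C.σ (s ++ [(ζ, y)]))
      (hw : S.weight η = (S.m k : ℝ)⁻¹)
      (hB : B.card = S.n k)
      (hBn : ∀ β ∈ B, ∀ β' ∈ B, ¬ S.Neighbours β β')
      (hmt : S.mtPart η = (S.m k : ℝ)⁻¹ • ∑ β ∈ B, dStar β)
      (hx : x = ∑ β ∈ B, Finsupp.single β ((S.m k : ℚ) / (S.n k : ℚ)))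
      (hlam : lam ∈ S.net q)
      (hlam' : |lam - S.lamOf ζ y| < 1 / (4 * (S.n (ζ.rank - 1) : ℝ) ^ 2)) :
      IsSpecial j (s ++ [(ζ, y)] ++ [(.step q ζ (2 * j - 1) a b 1 lam η, x)])

/-- `C.IsSpecialIn j G s` says that `s` is a `(Γ, j)`-special sequence, where `Γ = G` and
`Γ_q` is the set of the elements of `G` of rank at most `q`. -/
inductive IsSpecialIn (j : ℕ) : Set Node → List (Node × RatVec) → Prop
  | first {G : Set Node} {q : ℕ} {a b : Node} {ε : ℤˣ} {η : Node} {x : RatVec}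
      (hs : C.IsSpecial j [(.start q (2 * j - 1) a b ε 1 η, x)])
      (hη : η ∈ G) (hηq : η.rank ≤ q) :
      IsSpecialIn j G [(.start q (2 * j - 1) a b ε 1 η, x)]
  | next {G : Set Node} {s : List (Node × RatVec)} {ζ : Node} {y : RatVec}
      {q : ℕ} {a b : Node} {ε : ℤˣ} {lam : ℝ} {η : Node} {x : RatVec}
      (hs : C.IsSpecial j (s ++ [(ζ, y)] ++ [(.step q ζ (2 * j - 1) a b ε lam η, x)]))
      (hη : η ∈ G) (hηq : η.rank ≤ q) (hηq' : ¬ η.rank ≤ q - 1)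
      (hζ : ζ ∈ G)
      (hprev : IsSpecialIn j {γ ∈ G | γ.rank ≤ ζ.rank - 1} (s ++ [(ζ, y)])) :
      IsSpecialIn j G (s ++ [(ζ, y)] ++ [(.step q ζ (2 * j - 1) a b ε lam η, x)])

/-- `C.IsCompatible j G γ s` says that the node `γ`, of rank `q + 1`, is compatible with the
`(Γ_q, j)`-special sequence `s`, where `Γ_q` is the set of the elements of `G` of rank at most
`q`. -/
inductive IsCompatible (j : ℕ) (G : Set Node) : Node → List (Node × RatVec) → Prop
  | first {q : ℕ} {a b : Node} {ε ε₁ : ℤˣ} {η η₁ : Node} {x : RatVec}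
      (hγ : S.IsNode (.start q (2 * j - 1) a b ε 1 η))
      (hs : C.IsSpecialIn j {γ ∈ G | γ.rank ≤ q} [(.start q (2 * j - 1) a b ε₁ 1 η₁, x)])
      (hη : η ∈ G) (hηq : η.rank ≤ q)
      (hcomp : S.CompatibleTrees η η₁) :
      IsCompatible j G (.start q (2 * j - 1) a b ε 1 η) [(.start q (2 * j - 1) a b ε₁ 1 η₁, x)]
  | odd {s : List (Node × RatVec)} {ζ : Node} {y : RatVec}
      {q : ℕ} {a b : Node} {ε ε₁ : ℤˣ} {ξ η η₁ : Node} {lam₁ : ℝ} {x : RatVec}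
      (hγ : S.IsNode (.step q ξ (2 * j - 1) a b ε 1 η))
      (hs : C.IsSpecialIn j {γ ∈ G | γ.rank ≤ q}
        (s ++ [(ζ, y)] ++ [(.step q ζ (2 * j - 1) a b ε₁ lam₁ η₁, x)]))
      (hη : η ∈ G) (hηq : η.rank ≤ q) (hξ : ξ ∈ G) (hξq : ξ.rank ≤ q)
      (hprev : IsCompatible j G ξ (s ++ [(ζ, y)]))
      (hodd : Odd (ξ.age + 1))
      (hcomp : S.CompatibleTrees η η₁) :
      IsCompatible j G (.step q ξ (2 * j - 1) a b ε 1 η)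
        (s ++ [(ζ, y)] ++ [(.step q ζ (2 * j - 1) a b ε₁ lam₁ η₁, x)])
  | even {s : List (Node × RatVec)} {ζ : Node} {y : RatVec}
      {q : ℕ} {a b : Node} {ε₁ : ℤˣ} {ξ η : Node} {lam lam₁ : ℝ} {x : RatVec}
      (hγ : S.IsNode (.step q ξ (2 * j - 1) a b 1 lam η))
      (hs : C.IsSpecialIn j {γ ∈ G | γ.rank ≤ q}
        (s ++ [(ζ, y)] ++ [(.step q ζ (2 * j - 1) a b ε₁ lam₁ η, x)]))
      (hη : η ∈ G) (hηq : η.rank ≤ q) (hξ : ξ ∈ G) (hξq : ξ.rank ≤ q)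
      (hprev : IsCompatible j G ξ (s ++ [(ζ, y)]))
      (heven : Even (ξ.age + 1))
      (hlam : lam ∈ S.net q)
      (hlam' : |lam - S.lamOf ξ y| < 1 / (4 * (S.n ξ.rank : ℝ) ^ 2)) :
      IsCompatible j G (.step q ξ (2 * j - 1) a b 1 lam η)
        (s ++ [(ζ, y)] ++ [(.step q ζ (2 * j - 1) a b ε₁ lam₁ η, x)])

/-! ## The set `Γ` and the space -/

/-- The regular nodes of rank `q + 1`, where `G = Γ_q`. -/
def regularNodes (S : Scheme) (q : ℕ) (G : Set Node) : Set Node :=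
  {γ | S.IsNode γ ∧ ∃ j, 1 ≤ j ∧ j ≤ (q + 1) / 2 ∧
    ((∃ a b ε η, γ = .start q (2 * j) a b ε 1 η ∧ η ∈ G) ∨
      ∃ ξ a b ε η, γ = .step q ξ (2 * j) a b ε 1 η ∧ ξ ∈ G ∧ ξ.rank < q ∧
        η ∈ G ∧ ξ.rank < η.rank)}

/-- The special nodes of rank `q + 1`, where `G = Γ_q`. -/
def specialNodes (q : ℕ) (G : Set Node) : Set Node :=
  {γ | S.IsNode γ ∧ γ.rank = q + 1 ∧
    ∃ j, 1 ≤ j ∧ j ≤ (q + 1) / 2 ∧ ∃ s, C.IsCompatible j G γ s}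

/-- The sets `Γ_q`. -/
def level : ℕ → Set Node
  | 0 => ∅
  | 1 => {.init}
  | q + 2 => level (q + 1) ∪
      (regularNodes S (q + 1) (level (q + 1)) ∪ C.specialNodes (q + 1) (level (q + 1)))

/-- The set `Γ = ⋃ Γ_q`. -/
def Gamma : Set Node := ⋃ q, C.level q

end Coding

/-! ## Facts used in the definition of the space -/

theorem m_pos (S : Scheme) {j : ℕ} (hj : 1 ≤ j) : (1 : ℝ) ≤ (S.m j : ℝ) := by
  have h := S.m_strictMono.monotoneOn (Set.mem_Ici.2 le_rfl) (Set.mem_Ici.2 hj) hj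
  rw [S.m_one] at h
  have : 1 ≤ S.m j := by omega
  exact_mod_cast this

theorem eStar_support {γ : Node} (h : S.IsNode γ) :
    ∀ β, S.eStar γ β ≠ 0 → β = γ ∨ β.rank < γ.rank := by
  induction h with
  | init =>
    intro β hβ
    left
    by_contra hne
    exact hβ (by simp [eStar, dStar, Finsupp.single_apply, Ne.symm hne])
  | @start q j a b ε lam η hj hjq ha hb hab hbq hlam hη hηq hP iha ihb ihη =>
    intro β hβ
    by_cases hne : β = .start q j a b ε lam η
    · exact Or.inl hne
    right
    have h1 : S.eStar η β ≠ 0 := by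
      intro h0
      apply hβ
      classical
      simp [eStar, dStar, Finsupp.single_apply, Ne.symm hne, projStar, Finsupp.filter_apply, h0]
    rcases ihη β h1 with h2 | h2
    · subst h2; simp only [Node.rank_start, Node.rank_step] at *; omega
    · simp only [Node.rank_start, Node.rank_step] at *; omega
  | @step q p j ξ a b ε lam η hpq hj hjp hξ hξp hξw hξa ha hb hab hpa hbq hlam hη hpη hηq hP
      ihξ iha ihb ihη =>
    intro β hβ
    by_cases hne : β = .step q ξ j a b ε lam η
    · exact Or.inl hne
    right
    by_cases h1 : S.eStar η β = 0
    · have h2 : S.eStar ξ β ≠ 0 := by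
        intro h0
        apply hβ
        classical
        simp [eStar, dStar, Finsupp.single_apply, Ne.symm hne, projStar, Finsupp.filter_apply,
          h0, h1]
      rcases ihξ β h2 with h3 | h3
      · subst h3; simp only [Node.rank_start, Node.rank_step] at *; omega
      · simp only [Node.rank_start, Node.rank_step] at *; omega
    · rcases ihη β h1 with h3 | h3
      · subst h3; simp only [Node.rank_start, Node.rank_step] at *; omega
      · simp only [Node.rank_start, Node.rank_step] at *; omega

theorem abs_coeff_le (S : Scheme) {q j : ℕ} (hj : 1 ≤ j) (ε : ℤˣ) {lam : ℝ} (hlam : lam ∈ S.net q)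
    {t : ℝ} (ht : |t| ≤ 1) : |(S.m j : ℝ)⁻¹ * ((ε : ℤ) : ℝ) * (lam * t)| ≤ 1 := by
  have h1 : |(S.m j : ℝ)⁻¹| ≤ 1 := by
    rw [abs_inv, abs_of_nonneg (Nat.cast_nonneg _)]
    exact inv_le_one_of_one_le₀ (m_pos S hj)
  have h2 : |((ε : ℤ) : ℝ)| = 1 := by
    rcases Int.units_eq_one_or ε with h | h <;> simp [h]
  have h3 := S.net_subset q lam hlam
  rw [abs_mul, abs_mul, abs_mul, h2, mul_one]
  exact mul_le_one₀ h1 (by positivity) (mul_le_one₀ h3 (abs_nonneg _) ht)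

/-- The vectors `d_β` are bounded functions on the set of nodes. -/
theorem abs_eStar_le {γ : Node} (h : S.IsNode γ) : ∀ β, |S.eStar γ β| ≤ 1 := by
  induction h with
  | init =>
    intro β
    classical
    simp only [eStar, dStar, Finsupp.single_apply]
    split_ifs <;> simp
  | @start q j a b ε lam η hj hjq ha hb hab hbq hlam hη hηq hP iha ihb ihη =>
    intro β
    classical
    by_cases hne : β = .start q j a b ε lam η
    · have h0 : S.eStar η β = 0 := by
        by_contra h1
        rcases eStar_support hη β h1 with h2 | h2 <;> subst hne
        · rw [← h2] at hηq; simp only [Node.rank_start, Node.rank_step] at hηq; omega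
        · simp only [Node.rank_start, Node.rank_step] at h2; omega
      simp [eStar, dStar, projStar, Finsupp.filter_apply, ← hne, h0]
    · by_cases hI : β ∈ S.interval a b
      · simpa [eStar, dStar, Finsupp.single_apply, Ne.symm hne, projStar, Finsupp.filter_apply, hI]
          using abs_coeff_le S hj ε hlam (ihη β)
      · simp [eStar, dStar, Finsupp.single_apply, Ne.symm hne, projStar, Finsupp.filter_apply, hI]
  | @step q p j ξ a b ε lam η hpq hj hjp hξ hξp hξw hξa ha hb hab hpa hbq hlam hη hpη hηq hP
      ihξ iha ihb ihη =>
    intro β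
    classical
    by_cases hne : β = .step q ξ j a b ε lam η
    · have h0 : S.eStar η β = 0 := by
        by_contra h1
        rcases eStar_support hη β h1 with h2 | h2 <;> subst hne
        · rw [← h2] at hηq; simp only [Node.rank_start, Node.rank_step] at hηq; omega
        · simp only [Node.rank_start, Node.rank_step] at h2; omega
      have h0' : S.eStar ξ β = 0 := by
        by_contra h1
        rcases eStar_support hξ β h1 with h2 | h2 <;> subst hne
        · rw [← h2] at hξp; simp only [Node.rank_start, Node.rank_step] at hξp; omega
        · simp only [Node.rank_start, Node.rank_step] at h2; omega
      simp [eStar, dStar, projStar, Finsupp.filter_apply, ← hne, h0, h0']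
    · by_cases hI : β ∈ S.interval a b
      · have hβp : p < β.rank := by
          by_contra hcon
          have hlt := S.ord_rank β a (by omega)
          exact (S.ord.lt_iff_le_not_ge β a).1 hlt |>.2 hI.1
        have h0' : S.eStar ξ β = 0 := by
          by_contra h1
          rcases eStar_support hξ β h1 with h2 | h2
          · rw [← h2] at hξp; omega
          · omega
        simpa [eStar, dStar, Finsupp.single_apply, Ne.symm hne, projStar, Finsupp.filter_apply, hI,
          h0'] using abs_coeff_le S hj ε hlam (ihη β)
      · simpa [eStar, dStar, Finsupp.single_apply, Ne.symm hne, projStar, Finsupp.filter_apply, hI]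
          using ihξ β

namespace Coding

variable (C : Coding S)

theorem IsCompatible.isNode {C : Coding S} {j : ℕ} {G : Set Node} {γ : Node}
    {s : List (Node × RatVec)} (h : C.IsCompatible j G γ s) : S.IsNode γ := by
  cases h <;> assumption

theorem isNode_of_mem_level : ∀ (q : ℕ) {γ : Node}, γ ∈ C.level q → S.IsNode γ
  | 0, _, h => by simp [level] at h
  | 1, _, h => by
      simp only [level, Set.mem_singleton_iff] at h
      exact h ▸ IsNode.init
  | q + 2, _, h => by
      simp only [level] at h
      rcases h with h | h | h
      · exact isNode_of_mem_level (q + 1) h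
      · exact h.1
      · exact h.1

theorem isNode_of_mem {γ : Node} (h : γ ∈ C.Gamma) : S.IsNode γ := by
  obtain ⟨q, hq⟩ := Set.mem_iUnion.1 h
  exact C.isNode_of_mem_level q hq

/-- The space `ℓ_∞(Γ)`. -/
abbrev LInfty : Type := lp (fun _ : C.Gamma => ℝ) ⊤

/-- The vector `d_β ∈ ℓ_∞(Γ)`, `β ∈ Γ`: its value at `γ` is `e*_γ(d_β)`, the coefficient of
`d*_β` in `e*_γ`. -/
def dVec (β : C.Gamma) : C.LInfty :=
  ⟨fun γ => S.eStar γ.1 β.1, memℓp_infty ⟨1, by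
    rintro _ ⟨γ, rfl⟩
    exact abs_eStar_le (C.isNode_of_mem γ.2) β.1⟩⟩

/-- The space `𝔛_Kus`: the closed linear span of the vectors `d_β`, `β ∈ Γ`, in `ℓ_∞(Γ)`. -/
def XKus : Submodule ℝ C.LInfty :=
  (Submodule.span ℝ (Set.range C.dVec)).topologicalClosure

/-- The vector `d_β` as an element of `𝔛_Kus`. -/
def d (β : C.Gamma) : C.XKus :=
  ⟨C.dVec β, Submodule.le_topologicalClosure _ (Submodule.subset_span ⟨β, rfl⟩)⟩

end Coding

end Scheme

/-- A Schauder basis `(e_n)` of `X` is shrinking if its biorthogonal functionals `(e_n*)` form a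
basis of the dual space, that is, `f = ∑ f(e_n) e_n*` in norm for every `f` in the dual space. -/
def IsShrinking {X : Type*} [NormedAddCommGroup X] [NormedSpace ℝ X] (b : SchauderBasis ℝ X) :
    Prop :=
  ∀ f : StrongDual ℝ X,
    Filter.Tendsto (fun N : ℕ => ∑ i ∈ Finset.range N, f (b i) • b.coord i) Filter.atTop (nhds f)

end Kus

end

/-!
The proof works with finitely supported vectors `∑ v(β) d_β`, on which `e*_γ` acts by pairing
coefficients.

*Basis.* The projection of `e*_γ` to an initial segment `J` of the enumeration is a combination of
functionals `e*_δ` with `δ ∈ Γ ∩ J` and coefficients of absolute sum at most `2`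
(`rep_projStar_eStar`): either `J` cuts `e*_γ` inside one mt-term, which has a factor at most `1/4`,
or it gives back some `e*_ξ` from the evaluation analysis plus such a cut term. So the partial sum
operators have norm at most `2`, and each `d*_β` is a finite combination of the `e*_δ`.

*Shrinking.* It suffices that every functional `f` is small on vectors supported on large ranks.
Suppose its norm on all tails is nearly `c > 0`. Successive nearly norming vectors `y 0, y 1, …`, of
norm one, then have the property that all their convex combinations have norm close to one. Hence
some `e*_γ` has modulus close to one both at `y 0` and at the average of `y 1, …, y n`. A node of
weight `m_j⁻¹` is small on vectors with ranks up to `j` (`abs_ev_le_of_rank_le`), so the weight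
`m_j⁻¹` of `γ` satisfies `j ≤ r`, where `r` bounds the ranks in `y 0`. As the age of a node of
weight `m_j⁻¹` is at most `n_j`, the evaluation analysis of `γ` has at most `n_r` terms. All but
about `4 n_r` of the `y k` are then seen by a single mt-term, and thus with the factor `1/4`
(`exists_exceptional_ranks`). If `n` is chosen large with respect to `n_r`, the average cannot be
close to one.

*Dual.* The operator `ℓ_1(Γ) → 𝔛_Kus^*`, `a ↦ ∑ a(γ) e*_γ`, is bounded below, since by
`rep_projStar_eStar` any choice of signs on an initial segment of `Γ` extends to a vector of norm at
most `2` (`exists_extension`). Its range contains the functionals `d*_β`, and these span a dense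
subspace of the dual because the basis is shrinking.
-/

noncomputable section

namespace Kus

/-! ### Two criteria for Banach spaces -/

section Banach

variable {X : Type*} [NormedAddCommGroup X] [NormedSpace ℝ X]

/-- A biorthogonal system is a Schauder basis if its partial sum operators are uniformly bounded and
eventually fix each vector of a dense set. -/
theorem exists_schauderBasis {V : Type*} {D : V → X} (hD : DenseRange D) (e : ℕ → X)
    (φ : ℕ → StrongDual ℝ X) (hortho : ∀ i j, φ i (e j) = if i = j then 1 else 0) {K : ℝ}
    (hK : 0 ≤ K) (hbound : ∀ N v, ‖∑ i ∈ Finset.range N, φ i (D v) • e i‖ ≤ K * ‖D v‖)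
    (hfix : ∀ v, ∃ N₀, ∀ N ≥ N₀, ∑ i ∈ Finset.range N, φ i (D v) • e i = D v) :
    ∃ b : SchauderBasis ℝ X, (∀ i, b i = e i) ∧ ∀ i, b.coord i = φ i := by
  obtain ⟨P, hP⟩ : ∃ P : ℕ → X →L[ℝ] X, ∀ N x, P N x = ∑ i ∈ Finset.range N, φ i x • e i :=
    ⟨fun N => ∑ i ∈ Finset.range N, (φ i).smulRight (e i), by simp⟩
  simp only [← hP] at hbound hfix
  have hle : ∀ N x, ‖P N x‖ ≤ K * ‖x‖ := fun N x =>
    hD.induction_on x (isClosed_le (by fun_prop) (by fun_prop)) (hbound N)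
  have hexp : ∀ x, Filter.Tendsto (fun N => P N x) Filter.atTop (nhds x) := by
    intro x
    rw [Metric.tendsto_atTop]
    intro ε hε
    have hpos : 0 < ε / (K + 1) := by positivity
    obtain ⟨v, hv⟩ := hD.exists_dist_lt x hpos
    obtain ⟨N₀, hN₀⟩ := hfix v
    refine ⟨N₀, fun N hN => ?_⟩
    have h2 : P N x - x = P N (x - D v) - (x - D v) := by rw [map_sub, hN₀ N hN]; abel
    rw [dist_eq_norm] at hv ⊢
    rw [lt_div_iff₀ (by positivity)] at hv
    rw [h2]
    calc ‖P N (x - D v) - (x - D v)‖ ≤ ‖P N (x - D v)‖ + ‖x - D v‖ := norm_sub_le _ _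
      _ ≤ K * ‖x - D v‖ + ‖x - D v‖ := add_le_add (hle N _) le_rfl
      _ < ε := by linarith
  refine ⟨{ basis := e
            coord := φ
            ortho := fun i j => ?_
            expansion := fun x => ?_ }, fun _ => rfl, fun _ => rfl⟩
  · rw [hortho]
    by_cases h : i = j
    · simp [h]
    · simp [h]
  · rw [HasSum, SummationFilter.conditional_filter_eq_map_range, Filter.tendsto_map'_iff]
    exact (hexp x).congr fun N => hP N x

/-- A basis is shrinking if every functional is eventually small on the remainders of the
expansions of the vectors of a dense set. -/
theorem isShrinking_of_dense {V : Type*} {D : V → X} (hD : DenseRange D) (b : SchauderBasis ℝ X)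
    (h : ∀ f : StrongDual ℝ X, ∀ ε > 0, ∃ N₀, ∀ N ≥ N₀, ∀ v,
      |f (∑ i ∈ Finset.range N, b.coord i (D v) • b i - D v)| ≤ ε * ‖D v‖) : IsShrinking b := by
  intro f
  rw [Metric.tendsto_atTop]
  intro ε hε
  obtain ⟨N₀, hN₀⟩ := h f (ε / 2) (by positivity)
  refine ⟨N₀, fun N hN => ?_⟩
  rw [dist_eq_norm]
  refine lt_of_le_of_lt (ContinuousLinearMap.opNorm_le_bound _ (by positivity) fun x => ?_)
    (half_lt_self hε)
  refine hD.induction_on x (isClosed_le (by fun_prop) (by fun_prop)) fun v => ?_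
  refine le_trans (le_of_eq ?_) (hN₀ N hN v)
  rw [Real.norm_eq_abs]
  congr 1
  rw [sub_apply, sum_apply, map_sub, map_sum]
  simp [mul_comm]

/-- An operator from a Banach space to a dual space that is bounded below and whose range contains
the biorthogonal functionals of a shrinking basis is an isomorphism. -/
theorem nonempty_equiv_dual {E : Type*} [NormedAddCommGroup E] [NormedSpace ℝ E] [CompleteSpace E]
    (T : E →L[ℝ] StrongDual ℝ X) {K : NNReal} (hT : ∀ a, ‖a‖ ≤ K * ‖T a‖)
    {b : SchauderBasis ℝ X} (hb : IsShrinking b) (hrange : ∀ i, ∃ a, T a = b.coord i) :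
    Nonempty (StrongDual ℝ X ≃L[ℝ] E) := by
  have hanti : AntilipschitzWith K T := AddMonoidHomClass.antilipschitz_of_bound T hT
  have hclosed : IsClosed (Set.range T) := hanti.isClosed_range T.uniformContinuous
  have hsurj : Function.Surjective T := fun f =>
    hclosed.mem_of_tendsto (hb f) (Filter.Eventually.of_forall fun N =>
      Submodule.sum_mem (LinearMap.range T.toLinearMap) fun i _ =>
        Submodule.smul_mem _ _ (hrange i))
  exact ⟨(ContinuousLinearEquiv.ofBijective T
    (LinearMap.ker_eq_bot.2 hanti.injective) (LinearMap.range_eq_top.2 hsurj)).symm⟩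

/-- A lower estimate on finitely supported sequences extends to all of `ℓ_1`. -/
theorem norm_le_of_sum_single {ι : Type*} [DecidableEq ι]
    (T : lp (fun _ : ι => ℝ) 1 →L[ℝ] StrongDual ℝ X) {K : ℝ}
    (h : ∀ (a : ι → ℝ) (s : Finset ι), ∃ x : X, ‖x‖ ≤ K ∧
      ∑ i ∈ s, |a i| ≤ T (∑ i ∈ s, lp.single 1 i (a i)) x)
    (a : lp (fun _ : ι => ℝ) 1) : ‖a‖ ≤ K * ‖T a‖ := by
  have hclosed : IsClosed {a : lp (fun _ : ι => ℝ) 1 | ‖a‖ ≤ K * ‖T a‖} :=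
    isClosed_le (by fun_prop) (by fun_prop)
  refine hclosed.mem_of_tendsto (lp.hasSum_single ENNReal.one_ne_top a)
    (Filter.Eventually.of_forall fun s => ?_)
  obtain ⟨x, hx, hs⟩ := h a s
  calc ‖∑ i ∈ s, lp.single 1 i (a i)‖ ≤ ∑ i ∈ s, ‖lp.single (E := fun _ : ι => ℝ) 1 i (a i)‖ :=
        norm_sum_le _ _
    _ = ∑ i ∈ s, |a i| := Finset.sum_congr rfl fun i _ => by
        rw [lp.norm_single (by norm_num), Real.norm_eq_abs]
    _ ≤ T (∑ i ∈ s, lp.single 1 i (a i)) x := hs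
    _ ≤ ‖T (∑ i ∈ s, lp.single 1 i (a i))‖ * ‖x‖ :=
        (Real.le_norm_self _).trans (ContinuousLinearMap.le_opNorm _ _)
    _ ≤ ‖T (∑ i ∈ s, lp.single 1 i (a i))‖ * K := by gcongr
    _ = _ := mul_comm _ _

end Banach

namespace Scheme

variable {S : Scheme}

/-! ### Elementary properties of the parameters and of nodes -/

theorem m_injective {i j : ℕ} (hi : 1 ≤ i) (hj : 1 ≤ j)
    (h : (S.m i : ℝ)⁻¹ = (S.m j : ℝ)⁻¹) : i = j :=
  S.m_strictMono.injOn (Set.mem_Ici.2 hi) (Set.mem_Ici.2 hj)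
    (Nat.cast_injective (R := ℝ) (inv_injective h))

theorem add_three_le_m (S : Scheme) {j : ℕ} (hj : 1 ≤ j) : j + 3 ≤ S.m j := by
  induction j, hj using Nat.le_induction with
  | base => rw [S.m_one]
  | succ j hj ih =>
    have := S.m_strictMono (Set.mem_Ici.2 hj) (Set.mem_Ici.2 (by omega : 1 ≤ j + 1))
      (Nat.lt_succ_self j)
    omega

theorem inv_m_le (S : Scheme) {j : ℕ} (hj : 1 ≤ j) : (S.m j : ℝ)⁻¹ ≤ ((j : ℝ) + 3)⁻¹ := by
  have : ((j + 3 : ℕ) : ℝ) ≤ (S.m j : ℝ) := Nat.cast_le.2 (S.add_three_le_m hj)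
  push_cast at this
  exact inv_anti₀ (by positivity) this

theorem one_le_n (S : Scheme) {j : ℕ} (hj : 1 ≤ j) : 1 ≤ S.n j := by
  have h := S.n_strictMono.monotoneOn (Set.mem_Ici.2 le_rfl) (Set.mem_Ici.2 hj) hj
  rw [S.n_one] at h
  omega

theorem abs_coef_le (S : Scheme) {q j : ℕ} (ε : ℤˣ) {lam : ℝ} (hlam : lam ∈ S.net q) :
    |(S.m j : ℝ)⁻¹ * ((ε : ℤ) : ℝ) * lam| ≤ (S.m j : ℝ)⁻¹ := by
  have h2 : |((ε : ℤ) : ℝ)| = 1 := by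
    rcases Int.units_eq_one_or ε with h | h <;> simp [h]
  have h3 := S.net_subset q lam hlam
  rw [abs_mul, abs_mul, h2, mul_one, abs_of_nonneg (by positivity)]
  exact mul_le_of_le_one_right (by positivity) h3

theorem le_of_rank_lt {β γ : Node} (h : β.rank < γ.rank) : S.ord.le β γ :=
  ((S.ord.lt_iff_le_not_ge β γ).1 (S.ord_rank β γ h)).1

theorem rank_le_of_le {β γ : Node} (h : S.ord.le β γ) : β.rank ≤ γ.rank := by
  by_contra hc
  exact ((S.ord.lt_iff_le_not_ge γ β).1 (S.ord_rank γ β (not_le.1 hc))).2 h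

theorem eStar_self (γ : Node) : S.eStar γ γ = 1 := (S.eStar_triangular γ).1

theorem eStar_eq_zero_of_rank_lt {γ β : Node} (hγ : S.IsNode γ) (h : γ.rank < β.rank) :
    S.eStar γ β = 0 := by
  by_contra hne
  rcases eStar_support hγ β hne with rfl | h' <;> omega

theorem le_of_eStar_ne_zero {γ β : Node} (hγ : S.IsNode γ) (h : S.eStar γ β ≠ 0) :
    S.ord.le β γ := by
  rcases eStar_support hγ β h with rfl | h'
  · exact S.ord.le_refl _
  · exact le_of_rank_lt h'

theorem IsNode.one_le_rank {γ : Node} : 1 ≤ γ.rank := by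
  cases γ <;> simp [Node.rank]

/-- The age of a node of weight `m_j⁻¹` is at most `n_j`. -/
theorem IsNode.age_le {γ : Node} (h : S.IsNode γ) {j : ℕ} (hj : 1 ≤ j)
    (hw : S.weight γ = (S.m j : ℝ)⁻¹) : γ.age ≤ S.n j := by
  cases h with
  | init => simp [Node.age]
  | start hj' =>
    exact S.one_le_n hj
  | step hpq hj' hjp hξ hξp hξw hξa =>
    obtain rfl := m_injective hj' hj hw
    exact hξa

/-- Only finitely many nodes have rank at most `q`. -/
theorem finite_isNode_rank_le (S : Scheme) (q : ℕ) : {γ | S.IsNode γ ∧ γ.rank ≤ q}.Finite := by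
  induction q with
  | zero =>
    refine Set.Finite.subset Set.finite_empty fun γ hγ => ?_
    have := IsNode.one_le_rank (γ := γ)
    have := hγ.2
    omega
  | succ q ih =>
    set A := {γ | S.IsNode γ ∧ γ.rank ≤ q} with hA
    have h1 : (({Node.init} : Set Node) ∪
        (fun t : ℕ × Node × Node × ℤˣ × ℝ × Node =>
          Node.start q t.1 t.2.1 t.2.2.1 t.2.2.2.1 t.2.2.2.2.1 t.2.2.2.2.2) ''
          (Set.Iic q ×ˢ A ×ˢ A ×ˢ Set.univ ×ˢ (S.net q : Set ℝ) ×ˢ A) ∪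
        (fun t : Node × ℕ × Node × Node × ℤˣ × ℝ × Node =>
          Node.step q t.1 t.2.1 t.2.2.1 t.2.2.2.1 t.2.2.2.2.1 t.2.2.2.2.2.1 t.2.2.2.2.2.2) ''
          (A ×ˢ Set.Iic q ×ˢ A ×ˢ A ×ˢ Set.univ ×ˢ (S.net q : Set ℝ) ×ˢ A) ∪ A).Finite := by
      have hu : (Set.univ : Set ℤˣ).Finite := Set.finite_univ
      refine Set.Finite.union (Set.Finite.union (Set.Finite.union (Set.finite_singleton _) ?_) ?_)
        ih
      · exact ((Set.finite_Iic q).prod (ih.prod (ih.prod (hu.prod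
          ((S.net q).finite_toSet.prod ih))))).image _
      · exact (ih.prod ((Set.finite_Iic q).prod (ih.prod (ih.prod (hu.prod
          ((S.net q).finite_toSet.prod ih)))))).image _
    refine h1.subset ?_
    rintro γ ⟨hγ, hr⟩
    rcases Nat.lt_or_ge q γ.rank with hq | hq
    · left
      cases hγ with
      | init => exact Or.inl (Or.inl rfl)
      | @start q' j a b ε lam η hj hjq ha hb hab hbq hlam hη hηq hP =>
        obtain rfl : q' = q := by simp only [Node.rank_start] at hr hq; omega
        refine Or.inl (Or.inr ⟨(j, a, b, ε, lam, η), ?_, rfl⟩)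
        exact ⟨hjq, ⟨ha, (rank_le_of_le hab).trans hbq⟩, ⟨hb, hbq⟩, trivial, hlam, hη, hηq⟩
      | @step q' p j ξ a b ε lam η hpq hj hjp hξ hξp hξw hξa ha hb hab hpa hbq hlam hη hpη hηq hP =>
        obtain rfl : q' = q := by simp only [Node.rank_step] at hr hq; omega
        have hξq : ξ.rank ≤ q' := by omega
        have hjq : j ≤ q' := by omega
        refine Or.inr ⟨(ξ, j, a, b, ε, lam, η), ?_, rfl⟩
        exact ⟨⟨hξ, hξq⟩, hjq, ⟨ha, (rank_le_of_le hab).trans hbq⟩,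
          ⟨hb, hbq⟩, trivial, hlam, hη, hηq⟩
    · exact Or.inr ⟨hγ, hq⟩

namespace Coding

variable {C : Coding S}

/-! ### The set `Γ` -/

theorem IsCompatible.mem_of_start {j : ℕ} {G : Set Node} {q k : ℕ} {a b : Node} {ε : ℤˣ} {lam : ℝ}
    {η : Node} {s : List (Node × RatVec)} (h : C.IsCompatible j G (.start q k a b ε lam η) s) :
    η ∈ G := by
  cases h; assumption

theorem IsCompatible.mem_of_step {j : ℕ} {G : Set Node} {q k : ℕ} {ξ a b : Node} {ε : ℤˣ} {lam : ℝ}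
    {η : Node} {s : List (Node × RatVec)} (h : C.IsCompatible j G (.step q ξ k a b ε lam η) s) :
    ξ ∈ G ∧ η ∈ G := by
  cases h <;> exact ⟨by assumption, by assumption⟩

theorem level_subset_Gamma (q : ℕ) : C.level q ⊆ C.Gamma := Set.subset_iUnion _ q

/-- `Γ` contains the nodes `ξ` and `η` from which its elements are built (but not necessarily the
end points of their intervals), so that `e*_γ` for `γ ∈ Γ` only involves `d*_β` with `β ∈ Γ`. -/
theorem mem_Gamma_of_start {q j : ℕ} {a b : Node} {ε : ℤˣ} {lam : ℝ} {η : Node}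
    (h : Node.start q j a b ε lam η ∈ C.Gamma) : η ∈ C.Gamma := by
  obtain ⟨r, hr⟩ := Set.mem_iUnion.1 h
  induction r with
  | zero => simp [level] at hr
  | succ r ih =>
    cases r with
    | zero => simp [level] at hr
    | succ r =>
      simp only [level] at hr
      rcases hr with hr | ⟨-, i, -, -, h | h⟩ | ⟨-, -, i, -, -, s, hs⟩
      · exact ih hr
      · obtain ⟨a', b', ε', η', he, hη⟩ := h
        injection he
        subst_vars
        exact level_subset_Gamma _ hη
      · obtain ⟨ξ', a', b', ε', η', he, -⟩ := h
        cases he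
      · exact level_subset_Gamma _ hs.mem_of_start

theorem mem_Gamma_of_step {q j : ℕ} {ξ a b : Node} {ε : ℤˣ} {lam : ℝ} {η : Node}
    (h : Node.step q ξ j a b ε lam η ∈ C.Gamma) : ξ ∈ C.Gamma ∧ η ∈ C.Gamma := by
  obtain ⟨r, hr⟩ := Set.mem_iUnion.1 h
  induction r with
  | zero => simp [level] at hr
  | succ r ih =>
    cases r with
    | zero => simp [level] at hr
    | succ r =>
      simp only [level] at hr
      rcases hr with hr | ⟨-, i, -, -, h | h⟩ | ⟨-, -, i, -, -, s, hs⟩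
      · exact ih hr
      · obtain ⟨a', b', ε', η', he, -⟩ := h
        cases he
      · obtain ⟨ξ', a', b', ε', η', he, hξ, -, hη, -⟩ := h
        injection he
        subst_vars
        exact ⟨level_subset_Gamma _ hξ, level_subset_Gamma _ hη⟩
      · exact ⟨level_subset_Gamma _ hs.mem_of_step.1, level_subset_Gamma _ hs.mem_of_step.2⟩

theorem finite_Gamma_rank_le (C : Coding S) (q : ℕ) : {γ : C.Gamma | γ.1.rank ≤ q}.Finite :=
  Set.Finite.of_finite_image ((S.finite_isNode_rank_le q).subset (by
    rintro _ ⟨γ, hγ, rfl⟩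
    exact ⟨C.isNode_of_mem γ.2, hγ⟩)) Subtype.val_injective.injOn

theorem init_mem_level (q : ℕ) : Node.init ∈ C.level (q + 1) := by
  induction q with
  | zero => exact Set.mem_singleton _
  | succ q ih => exact Or.inl ih

/-- The regular nodes `(q+3, 0, m_2, {1}, 1, e*_1)` all lie in `Γ`, which is therefore infinite. -/
theorem infinite_Gamma (C : Coding S) : C.Gamma.Infinite := by
  refine Set.infinite_of_injective_forall_mem
    (f := fun q : ℕ => Node.start (q + 2) 2 .init .init 1 1 .init) ?_ ?_
  · intro q q' h
    injection h with h
    omega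
  · intro q
    have hP : projStar (S.interval .init .init) ((1 : ℝ) • S.eStar .init) ≠ 0 := by
      intro h0
      have h1 := DFunLike.congr_fun h0 Node.init
      have hI : Node.init ∈ S.interval .init .init := ⟨S.ord.le_refl _, S.ord.le_refl _⟩
      classical
      simp [projStar, hI, eStar_self] at h1
    refine level_subset_Gamma (q + 3) (Or.inr (Or.inl ⟨?_, 1, le_rfl, by omega, Or.inl
      ⟨.init, .init, 1, .init, rfl, init_mem_level _⟩⟩))
    exact IsNode.start (by omega) (by omega) .init .init (S.ord.le_refl _) (by simp [Node.rank])
      (S.one_mem_net _) .init (by simp [Node.rank]) hP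

/-- The increasing enumeration of `Γ`. -/
theorem exists_increasing_enumeration (C : Coding S) :
    ∃ g : ℕ ≃ C.Gamma, ∀ i k : ℕ, i < k → S.ord.lt (g i : Node) (g k : Node) := by
  classical
  have hfin : ∀ γ : C.Gamma, {β : C.Gamma | S.ord.lt β.1 γ.1}.Finite := fun γ =>
    (C.finite_Gamma_rank_le γ.1.rank).subset fun β hβ =>
      rank_le_of_le ((S.ord.lt_iff_le_not_ge _ _).1 hβ).1
  -- the position of an element of `Γ` among all elements of `Γ`
  let h : C.Gamma → ℕ := fun γ => (hfin γ).toFinset.card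
  have hmono : ∀ β γ : C.Gamma, S.ord.lt β.1 γ.1 → h β < h γ := by
    intro β γ hβγ
    refine Finset.card_lt_card ((Finset.ssubset_iff_of_subset fun δ hδ => ?_).2 ⟨β, ?_, ?_⟩)
    · simp only [Set.Finite.mem_toFinset, Set.mem_ofPred_eq] at hδ ⊢
      let _ := S.ord
      exact lt_trans hδ hβγ
    · simpa using hβγ
    · simp only [Set.Finite.mem_toFinset, Set.mem_ofPred_eq]
      let _ := S.ord
      exact lt_irrefl _
  have hle : ∀ β γ : C.Gamma, h β < h γ → S.ord.lt β.1 γ.1 := by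
    intro β γ hlt
    let _ := S.ord
    rcases lt_trichotomy β.1 γ.1 with h1 | h1 | h1
    · exact h1
    · rw [Subtype.ext h1] at hlt
      exact absurd hlt (lt_irrefl _)
    · exact absurd hlt (hmono γ β h1).le.not_gt
  have hinj : Function.Injective h := by
    intro β γ heq
    let _ := S.ord
    rcases lt_trichotomy β.1 γ.1 with h1 | h1 | h1
    · exact absurd heq (hmono β γ h1).ne
    · exact Subtype.ext h1
    · exact absurd heq (hmono γ β h1).ne'
  have : Infinite C.Gamma := C.infinite_Gamma.to_subtype
  have : Infinite (Set.range h) := (Set.infinite_range_of_injective hinj).to_subtype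
  let e := Nat.Subtype.orderIsoOfNat (Set.range h)
  refine ⟨e.toEquiv.trans (Equiv.ofInjective h hinj).symm, fun i k hik => hle _ _ ?_⟩
  have hval : ∀ i, h ((e.toEquiv.trans (Equiv.ofInjective h hinj).symm) i) = (e i : ℕ) := fun i =>
    congrArg Subtype.val ((Equiv.ofInjective h hinj).apply_symm_apply (e i))
  rw [hval, hval]
  exact e.strictMono hik

end Coding

/-! ### Finitely supported vectors and functionals -/

theorem projStar_apply (I : Set Node) [DecidablePred (· ∈ I)] (f : Functional) (β : Node) :
    projStar I f β = if β ∈ I then f β else 0 := by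
  simp only [projStar, Finsupp.filter_apply]
  congr

theorem projStar_eq_self {I : Set Node} {f : Functional} (h : ∀ β, f β ≠ 0 → β ∈ I) :
    projStar I f = f := by
  classical
  ext β
  rw [projStar_apply]
  split_ifs with hβ
  · rfl
  · by_contra hne
    exact hβ (h β (Ne.symm hne))

open Classical in
theorem eStar_start_apply {q j : ℕ} {a b : Node} {ε : ℤˣ} {lam : ℝ} {η β : Node}
    (hβ : β ≠ .start q j a b ε lam η) :
    S.eStar (.start q j a b ε lam η) β =
      (S.m j : ℝ)⁻¹ * ((ε : ℤ) : ℝ) * lam *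
        (if β ∈ S.interval a b then S.eStar η β else 0) := by
  simp [eStar, dStar, hβ.symm, projStar_apply, mul_assoc]

open Classical in
theorem eStar_step_apply {q j : ℕ} {ξ a b : Node} {ε : ℤˣ} {lam : ℝ} {η β : Node}
    (hβ : β ≠ .step q ξ j a b ε lam η) :
    S.eStar (.step q ξ j a b ε lam η) β =
      S.eStar ξ β + (S.m j : ℝ)⁻¹ * ((ε : ℤ) : ℝ) * lam *
        (if β ∈ S.interval a b then S.eStar η β else 0) := by
  simp [eStar, dStar, hβ.symm, projStar_apply, mul_assoc]

namespace Coding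

variable (C : Coding S)

/-- The value of the functional `f` at the vector `∑ v(β) d_β`, as a linear function of `v`. -/
def ev (f : Functional) : (C.Gamma →₀ ℝ) →ₗ[ℝ] ℝ :=
  Finsupp.linearCombination ℝ fun β : C.Gamma => f β

/-- The vector `∑ v(β) d_β` of `𝔛_Kus`. -/
def vec : (C.Gamma →₀ ℝ) →ₗ[ℝ] C.XKus := Finsupp.linearCombination ℝ C.d

variable {C}

theorem ev_apply (f : Functional) (v : C.Gamma →₀ ℝ) :
    C.ev f v = ∑ β ∈ v.support, v β * f β := by
  simp [ev, Finsupp.linearCombination_apply, Finsupp.sum]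

theorem ev_add (f g : Functional) (v : C.Gamma →₀ ℝ) : C.ev (f + g) v = C.ev f v + C.ev g v := by
  simp [ev_apply, mul_add, Finset.sum_add_distrib]

theorem ev_smul (c : ℝ) (f : Functional) (v : C.Gamma →₀ ℝ) : C.ev (c • f) v = c * C.ev f v := by
  simp only [ev_apply, Finset.mul_sum, Finsupp.smul_apply, smul_eq_mul]
  exact Finset.sum_congr rfl fun _ _ => by ring

theorem ev_congr {f g : Functional} {v : C.Gamma →₀ ℝ}
    (h : ∀ β ∈ v.support, f β = g β) : C.ev f v = C.ev g v := by
  simp only [ev_apply]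
  exact Finset.sum_congr rfl fun β hβ => by rw [h β hβ]

theorem ev_eq_zero {f : Functional} {v : C.Gamma →₀ ℝ}
    (h : ∀ β ∈ v.support, f β = 0) : C.ev f v = 0 := by
  rw [ev_apply]
  exact Finset.sum_eq_zero fun β hβ => by rw [h β hβ, mul_zero]

theorem ev_single (f : Functional) (β : C.Gamma) (t : ℝ) :
    C.ev f (Finsupp.single β t) = t * f β := by
  simp [ev]

theorem ev_dStar (β : C.Gamma) (v : C.Gamma →₀ ℝ) : C.ev (dStar β) v = v β := by
  classical
  rw [ev_apply, Finset.sum_eq_single β]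
  · simp [dStar]
  · intro δ _ hδ
    have : (β : Node) ≠ δ := fun h => hδ (Subtype.ext h.symm)
    simp [dStar, this]
  · intro h
    simp [Finsupp.notMem_support_iff.1 h]

theorem vec_apply (v : C.Gamma →₀ ℝ) (γ : C.Gamma) :
    ((C.vec v : C.XKus) : C.LInfty) γ = C.ev (S.eStar γ) v := by
  simp only [vec, ev]
  induction v using Finsupp.induction_linear with
  | zero => simp
  | add v w hv hw => simp only [map_add, Submodule.coe_add, lp.coeFn_add, Pi.add_apply, hv, hw]
  | single β t => simp [d, dVec]

theorem abs_ev_le_norm (v : C.Gamma →₀ ℝ) (γ : C.Gamma) :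
    |C.ev (S.eStar γ) v| ≤ ‖C.vec v‖ := by
  rw [← vec_apply, ← Real.norm_eq_abs]
  exact lp.norm_apply_le_norm ENNReal.top_ne_zero (C.vec v : C.LInfty) γ

theorem norm_vec_le {v : C.Gamma →₀ ℝ} {M : ℝ} (hM : 0 ≤ M)
    (h : ∀ γ : C.Gamma, |C.ev (S.eStar γ) v| ≤ M) : ‖C.vec v‖ ≤ M := by
  refine lp.norm_le_of_forall_le (f := (C.vec v : C.LInfty)) hM fun γ => ?_
  rw [vec_apply]
  exact h γ

theorem denseRange_vec : DenseRange C.vec := by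
  have h1 : ∀ v, ((C.vec v : C.XKus) : C.LInfty) = Finsupp.linearCombination ℝ C.dVec v := by
    intro v
    simp [vec, Finsupp.linearCombination_apply, Finsupp.sum, d]
  intro x
  rw [Metric.mem_closure_iff]
  intro r hr
  have hx : (x : C.LInfty) ∈ closure (Submodule.span ℝ (Set.range C.dVec) : Set C.LInfty) := x.2
  obtain ⟨y, hy, hxy⟩ := Metric.mem_closure_iff.1 hx r hr
  obtain ⟨v, rfl⟩ := (Finsupp.mem_span_range_iff_exists_finsupp).1 hy
  refine ⟨C.vec v, ⟨v, rfl⟩, ?_⟩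
  rw [Subtype.dist_eq, h1]
  exact hxy

/-! ### Projections in terms of the functionals `e*_γ` -/

variable (C) in
/-- `C.Rep J K f` says that `f` is a linear combination of functionals `e*_δ` with `δ ∈ Γ ∩ J` whose
coefficients have absolute sum at most `K`, that is, `f ∈ ℓ_1(Γ ∩ J)` with norm at most `K`. -/
def Rep (J : Set Node) (K : ℝ) (f : Functional) : Prop :=
  ∃ c : C.Gamma →₀ ℝ, (∀ δ ∈ c.support, (δ : Node) ∈ J) ∧ (∑ δ ∈ c.support, |c δ|) ≤ K ∧
    f = Finsupp.linearCombination ℝ (fun δ : C.Gamma => S.eStar δ) c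

theorem Rep.mono {J J' : Set Node} {K K' : ℝ} {f : Functional} (h : C.Rep J K f) (hJ : J ⊆ J')
    (hK : K ≤ K') : C.Rep J' K' f := by
  obtain ⟨c, h1, h2, h3⟩ := h
  exact ⟨c, fun δ hδ => hJ (h1 δ hδ), h2.trans hK, h3⟩

theorem Rep.add {J : Set Node} {K K' : ℝ} {f f' : Functional} (h : C.Rep J K f)
    (h' : C.Rep J K' f') : C.Rep J (K + K') (f + f') := by
  classical
  obtain ⟨c, h1, h2, rfl⟩ := h
  obtain ⟨c', h1', h2', rfl⟩ := h'
  refine ⟨c + c', fun δ hδ => ?_, ?_, by rw [map_add]⟩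
  · rcases Finset.mem_union.1 (Finsupp.support_add hδ) with h | h
    exacts [h1 δ h, h1' δ h]
  · have e1 : ∑ δ ∈ c.support, |c δ| = ∑ δ ∈ c.support ∪ c'.support, |c δ| :=
      Finset.sum_subset Finset.subset_union_left fun δ _ hδ => by
        simp [Finsupp.notMem_support_iff.1 hδ]
    have e2 : ∑ δ ∈ c'.support, |c' δ| = ∑ δ ∈ c.support ∪ c'.support, |c' δ| :=
      Finset.sum_subset Finset.subset_union_right fun δ _ hδ => by
        simp [Finsupp.notMem_support_iff.1 hδ]
    calc ∑ δ ∈ (c + c').support, |(c + c') δ|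
        ≤ ∑ δ ∈ c.support ∪ c'.support, |(c + c') δ| :=
          Finset.sum_le_sum_of_subset_of_nonneg Finsupp.support_add fun _ _ _ => abs_nonneg _
      _ ≤ ∑ δ ∈ c.support ∪ c'.support, (|c δ| + |c' δ|) :=
          Finset.sum_le_sum fun δ _ => abs_add_le _ _
      _ ≤ K + K' := by rw [Finset.sum_add_distrib, ← e1, ← e2]; exact add_le_add h2 h2'

theorem Rep.smul {J : Set Node} {K : ℝ} {f : Functional} (h : C.Rep J K f) (t : ℝ) :
    C.Rep J (|t| * K) (t • f) := by
  obtain ⟨c, h1, h2, rfl⟩ := h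
  refine ⟨t • c, fun δ hδ => h1 δ (Finsupp.support_smul hδ), ?_, by rw [map_smul]⟩
  calc ∑ δ ∈ (t • c).support, |(t • c) δ| ≤ ∑ δ ∈ c.support, |(t • c) δ| :=
        Finset.sum_le_sum_of_subset_of_nonneg Finsupp.support_smul fun _ _ _ => abs_nonneg _
    _ = |t| * ∑ δ ∈ c.support, |c δ| := by simp [Finset.mul_sum, abs_mul]
    _ ≤ |t| * K := mul_le_mul_of_nonneg_left h2 (abs_nonneg _)

theorem Rep.sub {J : Set Node} {K K' : ℝ} {f f' : Functional} (h : C.Rep J K f)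
    (h' : C.Rep J K' f') : C.Rep J (K + K') (f - f') := by
  have := h.add (h'.smul (-1))
  simpa [sub_eq_add_neg] using this

theorem rep_eStar {J : Set Node} {γ : Node} (hγ : γ ∈ C.Gamma) (hJ : γ ∈ J) :
    C.Rep J 1 (S.eStar γ) := by
  classical
  refine ⟨Finsupp.single ⟨γ, hγ⟩ 1, fun δ hδ => ?_, ?_, by simp⟩
  · rw [Finsupp.support_single _ one_ne_zero, Finset.mem_singleton] at hδ
    rwa [hδ]
  · rw [Finsupp.support_single _ one_ne_zero]
    simp

theorem ev_linearCombination {f : Functional} {c : C.Gamma →₀ ℝ}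
    (h : f = Finsupp.linearCombination ℝ (fun δ : C.Gamma => S.eStar δ) c) (v : C.Gamma →₀ ℝ) :
    C.ev f v = ∑ δ ∈ c.support, c δ * C.ev (S.eStar δ) v := by
  subst h
  induction c using Finsupp.induction_linear with
  | zero => simp [ev_apply]
  | add c c' hc hc' =>
    classical
    rw [map_add, ev_add, hc, hc']
    exact (Finsupp.sum_add_index' (h := fun (δ : C.Gamma) t => t * C.ev (S.eStar δ) v) (by simp)
      (by intros; ring)).symm
  | single δ t =>
    rw [Finsupp.linearCombination_single, ev_smul]
    exact (Finsupp.sum_single_index (h := fun (δ : C.Gamma) t => t * C.ev (S.eStar δ) v)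
      (by simp)).symm

theorem Rep.abs_ev_le {J : Set Node} {K M : ℝ} {f : Functional} (h : C.Rep J K f)
    {v : C.Gamma →₀ ℝ} (hM : 0 ≤ M)
    (hv : ∀ δ : C.Gamma, (δ : Node) ∈ J → |C.ev (S.eStar δ) v| ≤ M) : |C.ev f v| ≤ K * M := by
  obtain ⟨c, h1, h2, h3⟩ := h
  rw [ev_linearCombination h3]
  calc |∑ δ ∈ c.support, c δ * C.ev (S.eStar δ) v|
      ≤ ∑ δ ∈ c.support, |c δ * C.ev (S.eStar δ) v| := Finset.abs_sum_le_sum_abs _ _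
    _ ≤ ∑ δ ∈ c.support, |c δ| * M := Finset.sum_le_sum fun δ hδ => by
        rw [abs_mul]
        exact mul_le_mul_of_nonneg_left (hv δ (h1 δ hδ)) (abs_nonneg _)
    _ ≤ K * M := by rw [← Finset.sum_mul]; exact mul_le_mul_of_nonneg_right h2 hM

end Coding

variable (S) in
/-- Initial segments of the enumeration of the nodes. -/
def IsInitial (J : Set Node) : Prop := ∀ ⦃β γ : Node⦄, S.ord.le β γ → γ ∈ J → β ∈ J

theorem projStar_inter_interval {J : Set Node} {a b : Node} (hab : S.ord.le a b) (f : Functional) :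
    projStar (J ∩ S.interval a b) f =
      projStar (J ∩ {β | S.ord.le β b}) f - projStar (J ∩ {β | S.ord.lt β a}) f := by
  classical
  ext β
  have h1 : S.ord.le a β ↔ ¬ S.ord.lt β a := by
    let _ := S.ord
    exact not_lt.symm
  have h2 : S.ord.lt β a → S.ord.le β b := by
    let _ := S.ord
    exact fun h => h.le.trans hab
  simp only [Finsupp.sub_apply, projStar_apply, interval, Set.mem_inter_iff, Set.mem_ofPred_eq, h1]
  by_cases ha : S.ord.lt β a
  · simp [ha, h2 ha]
  · simp [ha]

theorem IsInitial.inter_le {J : Set Node} (hJ : S.IsInitial J) (b : Node) :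
    S.IsInitial (J ∩ {β | S.ord.le β b}) := fun _ _ h hγ =>
  ⟨hJ h hγ.1, S.ord.le_trans _ _ _ h hγ.2⟩

theorem IsInitial.inter_lt {J : Set Node} (hJ : S.IsInitial J) (b : Node) :
    S.IsInitial (J ∩ {β | S.ord.lt β b}) := fun _ _ h hγ => by
  let _ := S.ord
  exact ⟨hJ h hγ.1, lt_of_le_of_lt h hγ.2⟩

namespace Coding

variable {C : Coding S}

theorem rep_projStar_interval {J : Set Node} (hJ : S.IsInitial J) {K : ℝ} {f : Functional}
    (hf : ∀ J, S.IsInitial J → C.Rep J K (projStar J f)) {a b : Node} (hab : S.ord.le a b) :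
    C.Rep J (K + K) (projStar (J ∩ S.interval a b) f) := by
  rw [projStar_inter_interval hab]
  exact ((hf _ (hJ.inter_le b)).mono Set.inter_subset_left le_rfl).sub
    ((hf _ (hJ.inter_lt a)).mono Set.inter_subset_left le_rfl)

theorem abs_coef_mul_le {q j : ℕ} (hj : 1 ≤ j) (ε : ℤˣ) {lam : ℝ} (hlam : lam ∈ S.net q) :
    |(S.m j : ℝ)⁻¹ * ((ε : ℤ) : ℝ) * lam| ≤ 1 / 4 := by
  refine (S.abs_coef_le ε hlam).trans ((S.inv_m_le hj).trans ?_)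
  have : (1 : ℝ) ≤ j := by exact_mod_cast hj
  rw [one_div]
  exact inv_anti₀ (by norm_num) (by linarith)

/-- The projection of `e*_γ` to an initial segment `J` of the enumeration is an element of
`ℓ_1(Γ ∩ J)` of norm at most `2`.  The constant reproduces itself in the induction because the
weights are at most `1/4` and a projection to an interval costs at most twice as much as one to an
initial segment. -/
theorem rep_projStar_eStar {γ : Node} (hγ : γ ∈ C.Gamma) :
    ∀ J, S.IsInitial J → C.Rep J 2 (projStar J (S.eStar γ)) := by
  classical
  have key : ∀ γ : Node, γ ∈ C.Gamma → ∀ J, S.IsInitial J → γ ∈ J →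
      C.Rep J 2 (projStar J (S.eStar γ)) := by
    intro γ hγ J hJ hγJ
    rw [projStar_eq_self fun β hβ => hJ (le_of_eStar_ne_zero (C.isNode_of_mem hγ) hβ) hγJ]
    exact (rep_eStar hγ hγJ).mono subset_rfl (by norm_num)
  induction γ with
  | init =>
    intro J hJ
    by_cases hγJ : Node.init ∈ J
    · exact key _ hγ J hJ hγJ
    · have h0 : projStar J (S.eStar .init) = 0 := by
        ext β
        rw [projStar_apply]
        split_ifs with hβ
        · have : Node.init ≠ β := fun h => hγJ (h ▸ hβ)
          simp [eStar, dStar, this]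
        · rfl
      rw [h0]
      exact ⟨0, by simp, by simp, by simp⟩
  | start q j a b ε lam η _ _ ih =>
    intro J hJ
    by_cases hγJ : Node.start q j a b ε lam η ∈ J
    · exact key _ hγ J hJ hγJ
    cases C.isNode_of_mem hγ with
    | start hj hjq ha hb hab hbq hlam hη hηq hP =>
      have h0 : projStar J (S.eStar (.start q j a b ε lam η)) =
          ((S.m j : ℝ)⁻¹ * ((ε : ℤ) : ℝ) * lam) •
            projStar (J ∩ S.interval a b) (S.eStar η) := by
        ext β
        by_cases hβ : β ∈ J
        · have hne : β ≠ .start q j a b ε lam η := fun h => hγJ (h ▸ hβ)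
          simp [projStar_apply, hβ, eStar_start_apply hne]
        · simp [projStar_apply, hβ]
      rw [h0]
      refine ((rep_projStar_interval hJ (ih (mem_Gamma_of_start hγ)) hab).smul _).mono
        subset_rfl ?_
      have := abs_coef_mul_le hj ε hlam
      linarith
  | step q ξ j a b ε lam η ihξ _ _ ih =>
    intro J hJ
    by_cases hγJ : Node.step q ξ j a b ε lam η ∈ J
    · exact key _ hγ J hJ hγJ
    obtain ⟨hξΓ, hηΓ⟩ := mem_Gamma_of_step hγ
    cases C.isNode_of_mem hγ with
    | step hpq hj hjp hξ hξp hξw hξa ha hb hab hpa hbq hlam hη hpη hηq hP =>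
      have h0 : projStar J (S.eStar (.step q ξ j a b ε lam η)) =
          projStar J (S.eStar ξ) + ((S.m j : ℝ)⁻¹ * ((ε : ℤ) : ℝ) * lam) •
            projStar (J ∩ S.interval a b) (S.eStar η) := by
        ext β
        by_cases hβ : β ∈ J
        · have hne : β ≠ .step q ξ j a b ε lam η := fun h => hγJ (h ▸ hβ)
          simp [projStar_apply, hβ, eStar_step_apply hne]
        · simp [projStar_apply, hβ]
      rw [h0]
      by_cases haJ : a ∈ J
      -- an initial segment meeting the interval contains all nodes of rank at most `rank ξ`
      · have hξJ : ξ ∈ J := hJ (le_of_rank_lt (by omega)) haJ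
        rw [projStar_eq_self fun β hβ => hJ (le_of_eStar_ne_zero hξ hβ) hξJ]
        refine ((rep_eStar hξΓ hξJ).add
          ((rep_projStar_interval hJ (ih hηΓ) hab).smul _)).mono subset_rfl ?_
        have := abs_coef_mul_le hj ε hlam
        linarith
      · have h1 : projStar (J ∩ S.interval a b) (S.eStar η) = 0 := by
          ext β
          rw [projStar_apply]
          split_ifs with hβ
          · exact absurd (hJ hβ.2.1 hβ.1) haJ
          · rfl
        rw [h1, smul_zero, add_zero]
        exact ihξ hξΓ J hJ

/-- The functional `d*_β` is a finite linear combination of the `e*_δ`, `δ ∈ Γ`. -/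
theorem rep_dStar (β : C.Gamma) : C.Rep Set.univ 4 (dStar β) := by
  classical
  have hJ : S.IsInitial Set.univ := fun _ _ _ _ => trivial
  have h0 : dStar (β : Node) = projStar (Set.univ ∩ S.interval β β) (S.eStar β) := by
    ext δ
    have h1 : δ ∈ S.interval β β ↔ δ = β := by
      let _ := S.ord
      exact ⟨fun h => le_antisymm h.2 h.1, fun h => h ▸ ⟨le_rfl, le_rfl⟩⟩
    by_cases h : δ = β
    · subst h
      simp [projStar_apply, h1, eStar_self, dStar]
    · simp [projStar_apply, h1, h, dStar]
  rw [h0]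
  exact (rep_projStar_interval hJ (rep_projStar_eStar β.2) (S.ord.le_refl _)).mono
    subset_rfl (by norm_num)

/-! ### Estimates for `e*_γ` on block vectors -/

theorem ev_eStar_start {q j : ℕ} {a b : Node} {ε : ℤˣ} {lam : ℝ} {η : Node} {v : C.Gamma →₀ ℝ}
    (hv : ∀ β ∈ v.support, (β : Node).rank ≠ q + 1) :
    C.ev (S.eStar (.start q j a b ε lam η)) v =
      (S.m j : ℝ)⁻¹ * ((ε : ℤ) : ℝ) * lam * C.ev (projStar (S.interval a b) (S.eStar η)) v := by
  classical
  rw [← ev_smul]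
  refine ev_congr fun β hβ => ?_
  have hne : (β : Node) ≠ .start q j a b ε lam η := fun h => hv β hβ (by rw [h]; rfl)
  simp [eStar_start_apply hne, projStar_apply]

theorem ev_eStar_step {q j : ℕ} {ξ a b : Node} {ε : ℤˣ} {lam : ℝ} {η : Node} {v : C.Gamma →₀ ℝ}
    (hv : ∀ β ∈ v.support, (β : Node).rank ≠ q + 1) :
    C.ev (S.eStar (.step q ξ j a b ε lam η)) v = C.ev (S.eStar ξ) v +
      (S.m j : ℝ)⁻¹ * ((ε : ℤ) : ℝ) * lam * C.ev (projStar (S.interval a b) (S.eStar η)) v := by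
  classical
  rw [← ev_smul, ← ev_add]
  refine ev_congr fun β hβ => ?_
  have hne : (β : Node) ≠ .step q ξ j a b ε lam η := fun h => hv β hβ (by rw [h]; rfl)
  simp [eStar_step_apply hne, projStar_apply]

theorem ev_projStar_eq_zero {I : Set Node} {f : Functional} {v : C.Gamma →₀ ℝ}
    (h : ∀ β ∈ v.support, (β : Node) ∉ I) : C.ev (projStar I f) v = 0 := by
  classical
  exact ev_eq_zero fun β hβ => by simp [projStar_apply, h β hβ]

theorem abs_ev_interval_le {η a b : Node} (hη : η ∈ C.Gamma) (hab : S.ord.le a b)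
    (v : C.Gamma →₀ ℝ) :
    |C.ev (projStar (S.interval a b) (S.eStar η)) v| ≤ 4 * ‖C.vec v‖ := by
  have h := rep_projStar_interval (J := Set.univ) (fun _ _ _ _ => trivial)
    (rep_projStar_eStar hη) hab
  rw [Set.univ_inter] at h
  refine (h.abs_ev_le (norm_nonneg _) fun δ _ => abs_ev_le_norm v δ).trans (le_of_eq ?_)
  ring

/-- A node of weight `m_j⁻¹` is small on vectors supported on ranks up to `j`: all nodes `ξ_i` of
its evaluation analysis have rank greater than `j`, so only the first mt-term contributes. -/
theorem abs_ev_le_of_rank_le {γ : Node} (hγ : γ ∈ C.Gamma) {j : ℕ} (hj : 1 ≤ j)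
    (hw : S.weight γ = (S.m j : ℝ)⁻¹) {v : C.Gamma →₀ ℝ}
    (hv : ∀ β ∈ v.support, (β : Node).rank ≤ j) :
    |C.ev (S.eStar γ) v| ≤ (S.m j : ℝ)⁻¹ * (4 * ‖C.vec v‖) := by
  induction γ with
  | init =>
    have h1 : (1 : ℝ) = (S.m j : ℝ)⁻¹ := hw
    have h2 := S.inv_m_le hj
    have h3 : ((j : ℝ) + 3)⁻¹ < 1 := inv_lt_one_of_one_lt₀ (by
      have : (0 : ℝ) ≤ j := Nat.cast_nonneg j
      linarith)
    linarith
  | start q j' a b ε lam η _ _ _ =>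
    cases C.isNode_of_mem hγ with
    | start hj' hjq ha hb hab hbq hlam hη hηq hP =>
      obtain rfl := m_injective hj' hj hw
      rw [ev_eStar_start fun β hβ => by have := hv β hβ; omega, abs_mul]
      exact mul_le_mul (S.abs_coef_le ε hlam) (abs_ev_interval_le (mem_Gamma_of_start hγ) hab v)
        (abs_nonneg _) (by positivity)
  | step q ξ j' a b ε lam η ihξ _ _ _ =>
    obtain ⟨hξΓ, hηΓ⟩ := mem_Gamma_of_step hγ
    cases C.isNode_of_mem hγ with
    | step hpq hj' hjp hξ hξp hξw hξa ha hb hab hpa hbq hlam hη hpη hηq hP =>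
      obtain rfl := m_injective hj' hj hw
      rw [ev_eStar_step fun β hβ => by have := hv β hβ; omega, ev_projStar_eq_zero, mul_zero,
        add_zero]
      · exact ihξ hξΓ hξw
      · intro β hβ hI
        have h1 := hv β hβ
        have h2 := rank_le_of_le hI.1
        omega

theorem abs_ev_interval_le_of_notMem {η a b : Node} (hη : η ∈ C.Gamma) {lo hi : ℕ}
    (ha : a.rank ∉ Set.Ioc lo hi) (hb : b.rank ∉ Set.Ioc lo hi) {v : C.Gamma →₀ ℝ}
    (hv : ∀ β ∈ v.support, (β : Node).rank ∈ Set.Ioc lo hi) :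
    |C.ev (projStar (S.interval a b) (S.eStar η)) v| ≤ ‖C.vec v‖ := by
  classical
  simp only [Set.mem_Ioc, not_and_or, not_lt, not_le] at ha hb hv
  by_cases h : a.rank ≤ lo ∧ hi < b.rank
  · rw [ev_congr (g := S.eStar η)]
    · exact abs_ev_le_norm v ⟨η, hη⟩
    · intro β hβ
      have h1 := hv β hβ
      have hI : (β : Node) ∈ S.interval a b :=
        ⟨le_of_rank_lt (by omega), le_of_rank_lt (by omega)⟩
      simp [projStar_apply, hI]
  · rw [ev_projStar_eq_zero, abs_zero]
    · exact norm_nonneg _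
    · intro β hβ hI
      have h1 := hv β hβ
      have h2 := rank_le_of_le hI.1
      have h3 := rank_le_of_le hI.2
      omega

/-- Apart from block vectors whose range of ranks contains one of at most `4 age(γ) + 1` exceptional
ranks, `e*_γ` is bounded by `1/4` on block vectors of norm one.  The exceptional ranks are those of
the nodes `ξ_i` and of the end points of the intervals `I_i` in the evaluation analysis: a block
vector avoiding them is seen by a single mt-term, which carries the weight of `γ`. -/
theorem exists_exceptional_ranks {γ : Node} (hγ : γ ∈ C.Gamma) :
    ∃ T : Finset ℕ, T.card ≤ 4 * γ.age + 1 ∧ ∀ (lo hi : ℕ) (v : C.Gamma →₀ ℝ),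
      (∀ t ∈ T, t ∉ Set.Ioc lo hi) → (∀ β ∈ v.support, (β : Node).rank ∈ Set.Ioc lo hi) →
      |C.ev (S.eStar γ) v| ≤ 1 / 4 * ‖C.vec v‖ := by
  induction γ with
  | init =>
    refine ⟨{1}, by simp, fun lo hi v hT hv => ?_⟩
    rw [ev_eq_zero, abs_zero]
    · positivity
    · intro β hβ
      by_contra hne
      have h1 := hT 1 (Finset.mem_singleton_self 1)
      have h2 := hv β hβ
      rcases eStar_support IsNode.init _ hne with h | h
      · rw [h] at h2
        exact h1 h2
      · have h3 := IsNode.one_le_rank (γ := (β : Node))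
        exact absurd h h3.not_gt
  | start q j a b ε lam η _ _ _ =>
    cases C.isNode_of_mem hγ with
    | start hj hjq ha hb hab hbq hlam hη hηq hP =>
      refine ⟨{q + 1, a.rank, b.rank}, Finset.card_le_three.trans (by simp [Node.age]),
        fun lo hi v hT hv => ?_⟩
      simp only [Finset.mem_insert, Finset.mem_singleton, forall_eq_or_imp, forall_eq] at hT
      rw [ev_eStar_start fun β hβ h => hT.1 (h ▸ hv β hβ), abs_mul]
      exact mul_le_mul (abs_coef_mul_le hj ε hlam)
        (abs_ev_interval_le_of_notMem (mem_Gamma_of_start hγ) hT.2.1 hT.2.2 hv)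
        (abs_nonneg _) (by norm_num)
  | step q ξ j a b ε lam η ihξ _ _ _ =>
    obtain ⟨hξΓ, hηΓ⟩ := mem_Gamma_of_step hγ
    cases C.isNode_of_mem hγ with
    | step hpq hj hjp hξ hξp hξw hξa ha hb hab hpa hbq hlam hη hpη hηq hP =>
      obtain ⟨T, hcard, hT⟩ := ihξ hξΓ
      refine ⟨T ∪ {q + 1, a.rank, b.rank, ξ.rank}, ?_, fun lo hi v hT' hv => ?_⟩
      · refine (Finset.card_union_le _ _).trans
          ((add_le_add hcard Finset.card_le_four).trans (le_of_eq ?_))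
        simp only [Node.age]
        ring
      · simp only [Finset.mem_union, Finset.mem_insert, Finset.mem_singleton, or_imp,
          forall_and, forall_eq] at hT'
        obtain ⟨hTξ, h1, h2, h3, h4⟩ := hT'
        rw [ev_eStar_step fun β hβ h => h1 (h ▸ hv β hβ)]
        -- the block lies either beyond `ξ` or before the interval
        rcases Nat.lt_or_ge hi ξ.rank with hp | hp
        · rw [ev_projStar_eq_zero, mul_zero, add_zero]
          · exact hT lo hi v hTξ hv
          · intro β hβ hI
            have h5 := rank_le_of_le hI.1
            have h6 := (hv β hβ).2
            omega
        · rw [ev_eq_zero (f := S.eStar ξ), zero_add, abs_mul]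
          · exact mul_le_mul (abs_coef_mul_le hj ε hlam)
              (abs_ev_interval_le_of_notMem hηΓ h2 h3 hv) (abs_nonneg _) (by norm_num)
          · intro β hβ
            have h5 := (hv β hβ).1
            simp only [Set.mem_Ioc, not_and, not_le] at h4
            exact eStar_eq_zero_of_rank_lt hξ (by
              by_contra h6
              have := h4 (by omega)
              omega)

/-! ### Functionals are small on tail vectors -/

/-- A finite set meets at most as many intervals of a partition as it has elements. -/
theorem card_filter_inter_Ioc_le {r : ℕ → ℕ} (hr : Monotone r) (T : Finset ℕ) (n : ℕ)
    [DecidablePred fun k => ∃ t ∈ T, t ∈ Set.Ioc (r k) (r (k + 1))] :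
    ((Finset.range n).filter fun k => ∃ t ∈ T, t ∈ Set.Ioc (r k) (r (k + 1))).card ≤ T.card := by
  refine Finset.card_le_card_of_forall_subsingleton (fun k t => t ∈ Set.Ioc (r k) (r (k + 1)))
    (fun k hk => (Finset.mem_filter.1 hk).2) fun t _ k hk k' hk' => ?_
  by_contra hne
  rcases Nat.lt_or_gt_of_ne hne with h | h
  · have h0 : r (k + 1) ≤ r k' := hr (Nat.succ_le_of_lt h)
    have h1 := hk.2.2
    have h2 := hk'.2.1
    omega
  · have h0 : r (k' + 1) ≤ r k := hr (Nat.succ_le_of_lt h)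
    have h1 := hk'.2.2
    have h2 := hk.2.1
    omega

theorem exists_weight_eq {γ : Node} (h : S.IsNode γ) (hne : γ ≠ .init) :
    ∃ j, 1 ≤ j ∧ S.weight γ = (S.m j : ℝ)⁻¹ := by
  cases h with
  | init => exact absurd rfl hne
  | start hj => exact ⟨_, hj, rfl⟩
  | step _ hj => exact ⟨_, hj, rfl⟩

/-- The central estimate.  If `y 0` is followed by sufficiently many block vectors `y 1, y 2, …`
(how many depends on the ranks in `y 0` only), then no `e*_γ` is close to one in modulus at both
`y 0` and the average of the other `y k`: the first forces the weight of `γ`, hence its age, to be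
controlled by `y 0`, and then most of the other `y k` are seen with the factor `1/4`. -/
theorem sum_ev_le_of_ev_gt {r : ℕ → ℕ} (hr : Monotone r) (h3 : 3 ≤ r 0)
    {y : ℕ → C.Gamma →₀ ℝ} (hy : ∀ k, ∀ β ∈ (y k).support, (β : Node).rank ∈
      Set.Ioc (r k) (r (k + 1))) (hnorm : ∀ k, ‖C.vec (y k)‖ = 1) {γ : Node} (hγ : γ ∈ C.Gamma)
    (h0 : 98 / 100 < |C.ev (S.eStar γ) (y 0)|) (n : ℕ) :
    ∑ k ∈ Finset.range n, |C.ev (S.eStar γ) (y (k + 1))| ≤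
      n * (1 / 4) + (4 * S.n (r 1) + 1) := by
  classical
  have hnode := C.isNode_of_mem hγ
  have hne : γ ≠ .init := by
    rintro rfl
    rw [ev_eq_zero] at h0
    · norm_num at h0
    · intro β hβ
      have h1 := (hy 0 β hβ).1
      have h2 : Node.init.rank = 1 := rfl
      exact eStar_eq_zero_of_rank_lt hnode (by omega)
  obtain ⟨j, hj, hw⟩ := exists_weight_eq hnode hne
  have hr01 : r 0 ≤ r 1 := hr (Nat.zero_le 1)
  have hjr : j ≤ r 1 := by
    by_contra hlt
    have h1 := abs_ev_le_of_rank_le hγ hj hw (v := y 0) fun β hβ => by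
      have := (hy 0 β hβ).2
      simp only [zero_add] at this
      omega
    have h2 : (S.m j : ℝ)⁻¹ ≤ 6⁻¹ := (S.inv_m_le hj).trans (inv_anti₀ (by norm_num) (by
      have : (3 : ℝ) ≤ j := by exact_mod_cast (by omega : 3 ≤ j)
      linarith))
    rw [hnorm] at h1
    linarith
  have hage : γ.age ≤ S.n (r 1) := (hnode.age_le hj hw).trans
    (S.n_strictMono.monotoneOn (Set.mem_Ici.2 hj) (Set.mem_Ici.2 (by omega)) hjr)
  obtain ⟨T, hcard, hT⟩ := exists_exceptional_ranks hγ
  have hbad := card_filter_inter_Ioc_le (r := fun k => r (k + 1))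
    (fun a b h => hr (by omega)) T n
  have hterm : ∀ k ∈ Finset.range n, |C.ev (S.eStar γ) (y (k + 1))| ≤
      1 / 4 + if ∃ t ∈ T, t ∈ Set.Ioc (r (k + 1)) (r (k + 1 + 1)) then 1 else 0 := by
    intro k _
    split_ifs with h
    · have := abs_ev_le_norm (y (k + 1)) ⟨γ, hγ⟩
      rw [hnorm] at this
      linarith
    · push Not at h
      have := hT _ _ (y (k + 1)) h (hy (k + 1))
      rw [hnorm] at this
      linarith
  refine (Finset.sum_le_sum hterm).trans ?_
  rw [Finset.sum_add_distrib, Finset.sum_const, Finset.card_range, nsmul_eq_mul, Finset.sum_boole]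
  refine add_le_add le_rfl ?_
  exact_mod_cast hbad.trans (hcard.trans (by omega))

variable (C) in
/-- Finitely supported coefficient families supported on nodes of rank greater than `N`. -/
def tail (N : ℕ) : Submodule ℝ (C.Gamma →₀ ℝ) :=
  Finsupp.supported ℝ ℝ {β | N < (β : Node).rank}

theorem tail_antitone {N M : ℕ} (h : N ≤ M) : C.tail M ≤ C.tail N :=
  Finsupp.supported_mono fun _ hβ => lt_of_le_of_lt h hβ

theorem rank_of_mem_tail {N : ℕ} {v : C.Gamma →₀ ℝ} (h : v ∈ C.tail N) :
    ∀ β ∈ v.support, N < (β : Node).rank := fun _ hβ => (Finsupp.mem_supported _ _).1 h hβ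

/-- A bound for a functional on tail vectors improves by a fixed factor further out.  Otherwise one
could choose successive almost norming vectors `y 0, y 1, …`, and `(y 0 + n⁻¹ ∑ y k) / 2` would have
norm almost `1`, contrary to `sum_ev_le_of_ev_gt`. -/
theorem exists_tail_bound_improve (f : StrongDual ℝ C.XKus) {c : ℝ} (hc : 0 < c) {N : ℕ}
    (hf : ∀ v ∈ C.tail N, |f (C.vec v)| ≤ c * ‖C.vec v‖) :
    ∃ N', ∀ v ∈ C.tail N', |f (C.vec v)| ≤ 99 / 100 * c * ‖C.vec v‖ := by
  by_contra hcon
  push Not at hcon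
  have hex : ∀ M, ∃ v ∈ C.tail M, ‖C.vec v‖ = 1 ∧ 99 / 100 * c < f (C.vec v) := by
    intro M
    obtain ⟨v, hv, hlt⟩ := hcon M
    have hpos : 0 < ‖C.vec v‖ := by
      rw [norm_pos_iff]
      intro h0
      simp [h0] at hlt
    -- normalise `v` and choose the sign
    obtain ⟨s, hs, hsf⟩ : ∃ s : ℝ, |s| = 1 ∧ s * f (C.vec v) = |f (C.vec v)| := by
      rcases le_total 0 (f (C.vec v)) with h | h
      · exact ⟨1, by simp, by rw [abs_of_nonneg h, one_mul]⟩
      · exact ⟨-1, by simp, by rw [abs_of_nonpos h, neg_one_mul]⟩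
    refine ⟨(‖C.vec v‖⁻¹ * s) • v, Submodule.smul_mem _ _ hv, ?_, ?_⟩
    · rw [map_smul, norm_smul, norm_mul, norm_inv, norm_norm, Real.norm_eq_abs, hs, mul_one,
        inv_mul_cancel₀ hpos.ne']
    · rw [map_smul, map_smul, smul_eq_mul, mul_assoc, hsf, inv_mul_eq_div, lt_div_iff₀ hpos]
      exact hlt
  choose F hFt hFn hFf using hex
  let H : ℕ → ℕ := fun M => max M ((F M).support.sup fun β => (β : Node).rank)
  -- the ranks in `y k := F (r k)` lie in `(r k, r (k + 1)]`; starting at `3` makes `4 / m_j`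
  -- smaller than `98 / 100` for `j ≥ r 1`
  let r : ℕ → ℕ := fun k => H^[k] (max N 3)
  have hr_succ : ∀ k, r (k + 1) = H (r k) := fun k => Function.iterate_succ_apply' H k _
  have hr : Monotone r := monotone_nat_of_le_succ fun k => by
    rw [hr_succ]
    exact le_max_left _ _
  have hr0 : r 0 = max N 3 := rfl
  let y : ℕ → C.Gamma →₀ ℝ := fun k => F (r k)
  have hy : ∀ k, ∀ β ∈ (y k).support, (β : Node).rank ∈ Set.Ioc (r k) (r (k + 1)) := by
    intro k β hβ
    refine ⟨rank_of_mem_tail (hFt (r k)) β hβ, ?_⟩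
    rw [hr_succ]
    exact (Finset.le_sup (f := fun β : C.Gamma => (β : Node).rank) hβ).trans (le_max_right _ _)
  have hyN : ∀ k, y k ∈ C.tail N := fun k => tail_antitone
    ((le_max_left N 3).trans (hr (Nat.zero_le k))) (hFt (r k))
  -- `A` bounds the number of exceptional blocks, so that these contribute at most `1 / 4` to an
  -- average over `4 A` blocks
  set A : ℕ := 4 * S.n (r 1) + 1 with hA
  set n : ℕ := 4 * A with hn
  have hn0 : (0 : ℝ) < n := by
    rw [hn, hA]
    positivity
  let z : C.Gamma →₀ ℝ := (1 / 2 : ℝ) • (y 0 + (n : ℝ)⁻¹ • ∑ k ∈ Finset.range n, y (k + 1))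
  have hzN : z ∈ C.tail N := Submodule.smul_mem _ _ (Submodule.add_mem _ (hyN 0)
    (Submodule.smul_mem _ _ (Submodule.sum_mem _ fun k _ => hyN _)))
  have hlin : ∀ φ : (C.Gamma →₀ ℝ) →ₗ[ℝ] ℝ,
      φ z = 1 / 2 * (φ (y 0) + (n : ℝ)⁻¹ * ∑ k ∈ Finset.range n, φ (y (k + 1))) := by
    intro φ
    simp only [z, map_smul, map_add, map_sum, smul_eq_mul]
  have hfz : 99 / 100 * c < f (C.vec z) := by
    have h1 := hlin (f.toLinearMap ∘ₗ C.vec)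
    simp only [LinearMap.comp_apply, ContinuousLinearMap.coe_coe] at h1
    have h2 : (n : ℝ) * (99 / 100 * c) ≤ ∑ k ∈ Finset.range n, f (C.vec (y (k + 1))) := by
      have := Finset.card_nsmul_le_sum (Finset.range n) (fun k => f (C.vec (y (k + 1))))
        (99 / 100 * c) fun k _ => (hFf _).le
      rwa [Finset.card_range, nsmul_eq_mul] at this
    have h3 : 99 / 100 * c ≤ (n : ℝ)⁻¹ * ∑ k ∈ Finset.range n, f (C.vec (y (k + 1))) := by
      rw [inv_mul_eq_div, le_div_iff₀ hn0]
      linarith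
    have h4 : 99 / 100 * c < f (C.vec (y 0)) := hFf _
    rw [h1]
    linarith
  have hz : 99 / 100 < ‖C.vec z‖ := by
    have h1 := (le_abs_self _).trans (hf z hzN)
    by_contra h2
    have := mul_le_mul_of_nonneg_left (not_lt.1 h2) hc.le
    linarith
  obtain ⟨γ, hγ⟩ : ∃ γ : C.Gamma, 99 / 100 < |C.ev (S.eStar γ) z| := by
    by_contra h
    push Not at h
    exact absurd (norm_vec_le (by norm_num) h) (not_le.2 hz)
  have hle1 : ∀ k, |C.ev (S.eStar γ) (y k)| ≤ 1 := fun k =>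
    (abs_ev_le_norm (y k) γ).trans (hFn _).le
  have hsum1 : ∑ k ∈ Finset.range n, |C.ev (S.eStar γ) (y (k + 1))| ≤ n := by
    have := Finset.sum_le_card_nsmul (Finset.range n)
      (fun k => |C.ev (S.eStar γ) (y (k + 1))|) 1 fun k _ => hle1 _
    simpa using this
  have hev : |C.ev (S.eStar γ) z| ≤ 1 / 2 * (|C.ev (S.eStar γ) (y 0)| +
      (n : ℝ)⁻¹ * ∑ k ∈ Finset.range n, |C.ev (S.eStar γ) (y (k + 1))|) := by
    rw [hlin, abs_mul, abs_of_pos (by norm_num : (0 : ℝ) < 1 / 2)]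
    refine mul_le_mul_of_nonneg_left ((abs_add_le _ _).trans (add_le_add le_rfl ?_)) (by norm_num)
    rw [abs_mul, abs_of_pos (inv_pos.2 hn0)]
    exact mul_le_mul_of_nonneg_left (Finset.abs_sum_le_sum_abs _ _) (inv_pos.2 hn0).le
  have h0 : 98 / 100 < |C.ev (S.eStar γ) (y 0)| := by
    have : (n : ℝ)⁻¹ * ∑ k ∈ Finset.range n, |C.ev (S.eStar γ) (y (k + 1))| ≤ 1 := by
      rw [inv_mul_eq_div, div_le_one hn0]
      exact hsum1
    linarith
  have hhalf : (n : ℝ)⁻¹ * ∑ k ∈ Finset.range n, |C.ev (S.eStar γ) (y (k + 1))| ≤ 1 / 2 := by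
    have := sum_ev_le_of_ev_gt hr (by rw [hr0]; exact le_max_right _ _) hy (fun k => hFn _) γ.2 h0 n
    have hnA : (n : ℝ) = 4 * (4 * S.n (r 1) + 1) := by rw [hn, hA]; push_cast; ring
    rw [inv_mul_eq_div, div_le_iff₀ hn0]
    linarith
  have := hle1 0
  linarith

/-- The restrictions of a functional to the tails of the FDD tend to zero in norm. -/
theorem exists_tail_bound (f : StrongDual ℝ C.XKus) {ε : ℝ} (hε : 0 < ε) :
    ∃ N, ∀ v ∈ C.tail N, |f (C.vec v)| ≤ ε * ‖C.vec v‖ := by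
  have key : ∀ k : ℕ, ∃ N, ∀ v ∈ C.tail N,
      |f (C.vec v)| ≤ (99 / 100) ^ k * (‖f‖ + 1) * ‖C.vec v‖ := by
    intro k
    induction k with
    | zero =>
      refine ⟨0, fun v _ => ?_⟩
      rw [pow_zero, one_mul, ← Real.norm_eq_abs]
      refine (f.le_opNorm _).trans (mul_le_mul_of_nonneg_right ?_ (norm_nonneg _))
      linarith
    | succ k ih =>
      obtain ⟨N, hN⟩ := ih
      obtain ⟨N', hN'⟩ := exists_tail_bound_improve f (by positivity) hN
      refine ⟨N', fun v hv => (hN' v hv).trans (le_of_eq ?_)⟩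
      ring
  have hpos : 0 < ‖f‖ + 1 := by positivity
  obtain ⟨k, hk⟩ := exists_pow_lt_of_lt_one (div_pos hε hpos) (by norm_num : (99 / 100 : ℝ) < 1)
  obtain ⟨N, hN⟩ := key k
  refine ⟨N, fun v hv => (hN v hv).trans (mul_le_mul_of_nonneg_right ?_ (norm_nonneg _))⟩
  exact ((lt_div_iff₀ hpos).1 hk).le

/-! ### The basis and its shrinking property -/

/-- The map `ℓ_1(Γ) → 𝔛_Kus^*` sending `a` to the functional `x ↦ ∑ a(γ) x(γ)`. -/
def dualMap (C : Coding S) : lp (fun _ : C.Gamma => ℝ) 1 →L[ℝ] StrongDual ℝ C.XKus :=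
  (C.XKus.subtypeL.precomp ℝ) ∘L
    lp.dualPairing 1 ⊤ (fun _ : C.Gamma => ContinuousLinearMap.mul ℝ ℝ) (K := 1)
      (fun _ => by simp)

theorem dualMap_apply (a : lp (fun _ : C.Gamma => ℝ) 1) (x : C.XKus) :
    C.dualMap a x = ∑' γ, a γ * (x : C.LInfty) γ := rfl

theorem dualMap_single [DecidableEq C.Gamma] (γ : C.Gamma) (t : ℝ) (x : C.XKus) :
    C.dualMap (lp.single 1 γ t) x = t * (x : C.LInfty) γ := by
  rw [dualMap_apply, tsum_eq_single γ]
  · simp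
  · intro δ hδ
    simp [lp.single_apply, hδ]

theorem exists_coord (C : Coding S) (β : C.Gamma) :
    ∃ a, ∀ v, C.dualMap a (C.vec v) = v β := by
  classical
  obtain ⟨c, -, -, hc⟩ := rep_dStar β
  refine ⟨∑ δ ∈ c.support, lp.single 1 δ (c δ), fun v => ?_⟩
  rw [map_sum, sum_apply, ← ev_dStar, ev_linearCombination hc]
  exact Finset.sum_congr rfl fun δ _ => by rw [dualMap_single, vec_apply]

open Classical in
/-- The restriction of a coefficient family to a set of nodes. -/
def restrict (J : Set Node) (v : C.Gamma →₀ ℝ) : C.Gamma →₀ ℝ :=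
  v.filter fun β => (β : Node) ∈ J

theorem restrict_apply (J : Set Node) [DecidablePred (· ∈ J)] (v : C.Gamma →₀ ℝ) (β : C.Gamma) :
    restrict J v β = if (β : Node) ∈ J then v β else 0 := by
  rw [restrict, Finsupp.filter_apply]
  congr

theorem ev_restrict (f : Functional) (J : Set Node) (v : C.Gamma →₀ ℝ) :
    C.ev f (restrict J v) = C.ev (projStar J f) v := by
  classical
  rw [restrict, ev_apply, ev_apply, Finsupp.support_filter, Finset.sum_filter]
  refine Finset.sum_congr rfl fun β _ => ?_
  by_cases h : (β : Node) ∈ J <;> simp [projStar_apply, h]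

/-- Restricting a vector to an initial segment of the enumeration at most doubles its norm. -/
theorem norm_vec_restrict_le {J : Set Node} (hJ : S.IsInitial J) (v : C.Gamma →₀ ℝ) :
    ‖C.vec (restrict J v)‖ ≤ 2 * ‖C.vec v‖ := by
  refine norm_vec_le (by positivity) fun γ => ?_
  rw [ev_restrict]
  exact (rep_projStar_eStar γ.2 J hJ).abs_ev_le (norm_nonneg _) fun δ _ => abs_ev_le_norm v δ

theorem isInitial_lt (γ : Node) : S.IsInitial {β | S.ord.lt β γ} := fun _ _ h hγ => by
  let _ := S.ord
  exact lt_of_le_of_lt h hγ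

theorem lt_enumeration_iff (g : ℕ ≃ C.Gamma)
    (hg : ∀ i k : ℕ, i < k → S.ord.lt (g i : Node) (g k : Node)) (N : ℕ) (β : C.Gamma) :
    S.ord.lt β (g N) ↔ g.symm β < N := by
  let _ := S.ord
  have hmono : StrictMono fun i => (g i : Node) := fun i k h => hg i k h
  obtain ⟨i, rfl⟩ := g.surjective β
  rw [Equiv.symm_apply_apply]
  exact hmono.lt_iff_lt

/-- A finite set is contained in all large initial segments of an enumeration. -/
theorem exists_forall_symm_lt {α : Type*} (g : ℕ ≃ α) {A : Set α} (hA : A.Finite) :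
    ∃ N₀, ∀ N ≥ N₀, ∀ β ∈ A, g.symm β < N := by
  obtain ⟨M, hM⟩ := (hA.image g.symm).bddAbove
  exact ⟨M + 1, fun N hN β hβ => lt_of_le_of_lt (hM ⟨β, hβ, rfl⟩) (Nat.lt_of_succ_le hN)⟩

theorem exists_shrinking_basis (C : Coding S) (g : ℕ ≃ C.Gamma)
    (hg : ∀ i k : ℕ, i < k → S.ord.lt (g i : Node) (g k : Node)) :
    ∃ b : SchauderBasis ℝ C.XKus, (∀ i, b i = C.d (g i)) ∧ IsShrinking b ∧
      ∀ i, b.coord i ∈ Set.range C.dualMap := by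
  classical
  choose a ha using C.exists_coord
  have hgJ := lt_enumeration_iff g hg
  -- the restriction of a vector to the first `N` elements of `Γ`
  obtain ⟨R, hRapply, hRle⟩ : ∃ R : ℕ → (C.Gamma →₀ ℝ) → (C.Gamma →₀ ℝ),
      (∀ N v β, R N v β = if g.symm β < N then v β else 0) ∧
      ∀ N v, ‖C.vec (R N v)‖ ≤ 2 * ‖C.vec v‖ :=
    ⟨fun N => restrict {β | S.ord.lt β (g N)},
      fun N v β => by simp only [restrict_apply, Set.mem_ofPred_eq, hgJ],
      fun N => norm_vec_restrict_le (isInitial_lt _)⟩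
  have hR : ∀ N v, ∑ i ∈ Finset.range N, Finsupp.single (g i) (v (g i)) = R N v := by
    intro N v
    ext β
    obtain ⟨k, rfl⟩ := g.surjective β
    rw [Finsupp.finsetSum_apply]
    simp only [hRapply, Finsupp.single_apply, g.injective.eq_iff,
      Equiv.symm_apply_apply, Finset.sum_ite_eq', Finset.mem_range]
  have hP : ∀ N v, ∑ i ∈ Finset.range N, C.dualMap (a (g i)) (C.vec v) • C.d (g i) =
      C.vec (R N v) := by
    intro N v
    rw [← hR, map_sum]
    exact Finset.sum_congr rfl fun i _ => by rw [ha]; simp [vec]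
  have hortho : ∀ i j, C.dualMap (a (g i)) (C.d (g j)) = if i = j then 1 else 0 := by
    intro i j
    have h1 : C.d (g j) = C.vec (Finsupp.single (g j) 1) := by simp [vec]
    rw [h1, ha]
    simp [Finsupp.single_apply, g.injective.eq_iff, eq_comm]
  have hbound : ∀ N v, ‖∑ i ∈ Finset.range N, C.dualMap (a (g i)) (C.vec v) • C.d (g i)‖ ≤
      2 * ‖C.vec v‖ := by
    intro N v
    rw [hP]
    exact hRle N v
  have hfix : ∀ v, ∃ N₀, ∀ N ≥ N₀,
      ∑ i ∈ Finset.range N, C.dualMap (a (g i)) (C.vec v) • C.d (g i) = C.vec v := by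
    intro v
    obtain ⟨N₀, hN₀⟩ := exists_forall_symm_lt g v.support.finite_toSet
    refine ⟨N₀, fun N hN => ?_⟩
    have hRv : R N v = v := by
      ext β
      rw [hRapply]
      split_ifs with h
      · rfl
      · by_contra hne
        exact h (hN₀ N hN β (Finset.mem_coe.2 (Finsupp.mem_support_iff.2 (Ne.symm hne))))
    rw [hP, hRv]
  obtain ⟨b, hb, hcoord⟩ := exists_schauderBasis C.denseRange_vec (fun i => C.d (g i))
    (fun i => C.dualMap (a (g i))) hortho (by norm_num) hbound hfix
  refine ⟨b, hb, isShrinking_of_dense C.denseRange_vec b fun f ε hε => ?_,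
    fun i => ⟨a (g i), (hcoord i).symm⟩⟩
  obtain ⟨M, hM⟩ := exists_tail_bound f (show (0 : ℝ) < ε / 3 by positivity)
  obtain ⟨N₀, hN₀⟩ := exists_forall_symm_lt g (C.finite_Gamma_rank_le M)
  refine ⟨N₀, fun N hN v => ?_⟩
  simp only [hcoord, hb, hP]
  have hmem : R N v - v ∈ C.tail M := by
    refine (Finsupp.mem_supported _ _).2 fun β hβ => ?_
    by_contra hle
    have h1 : g.symm β < N := hN₀ N hN β (not_lt (a := M) (b := (β : Node).rank).1 hle)
    exact (Finsupp.mem_support_iff.1 (Finset.mem_coe.1 hβ))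
      (by rw [Finsupp.sub_apply, hRapply, if_pos h1, sub_self])
  have h2 := hM _ hmem
  rw [map_sub] at h2
  have h3 : ‖C.vec (R N v) - C.vec v‖ ≤ 3 * ‖C.vec v‖ := by
    have := norm_sub_le (C.vec (R N v)) (C.vec v)
    have : ‖C.vec (R N v)‖ ≤ 2 * ‖C.vec v‖ := hRle N v
    linarith
  calc _ ≤ ε / 3 * ‖C.vec (R N v) - C.vec v‖ := h2
    _ ≤ ε / 3 * (3 * ‖C.vec v‖) := by gcongr
    _ = ε * ‖C.vec v‖ := by ring

/-! ### The dual space -/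

/-- Prescribed values of modulus at most one on an initial segment of `Γ` are attained by a vector
of norm at most two. -/
theorem exists_extension (g : ℕ ≃ C.Gamma)
    (hg : ∀ i k : ℕ, i < k → S.ord.lt (g i : Node) (g k : Node)) (s : C.Gamma → ℝ)
    (hs : ∀ γ, |s γ| ≤ 1) (N : ℕ) :
    ∃ v, (∀ i < N, C.ev (S.eStar (g i)) v = s (g i)) ∧ ‖C.vec v‖ ≤ 2 := by
  classical
  -- the matrix `(e*_γ(d_β))` is unitriangular
  have hex : ∃ v : C.Gamma →₀ ℝ, (∀ i < N, C.ev (S.eStar (g i)) v = s (g i)) ∧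
      ∀ β ∈ v.support, (β : Node) ∈ {β | S.ord.lt β (g N)} := by
    induction N with
    | zero => exact ⟨0, by simp, by simp⟩
    | succ N ih =>
      obtain ⟨v, hv, hsupp⟩ := ih
      refine ⟨v + Finsupp.single (g N) (s (g N) - C.ev (S.eStar (g N)) v), fun i hi => ?_,
        fun β hβ => ?_⟩
      · rw [map_add, ev_single]
        rcases Nat.lt_succ_iff_lt_or_eq.1 hi with h | rfl
        · have h0 : S.eStar (g i) (g N) = 0 := by
            by_contra hne
            exact ((S.ord.lt_iff_le_not_ge _ _).1 (hg i N h)).2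
              (le_of_eStar_ne_zero (C.isNode_of_mem (g i).2) hne)
          rw [h0, mul_zero, add_zero, hv i h]
        · rw [eStar_self]
          ring
      · rcases Finset.mem_union.1 (Finsupp.support_add hβ) with h | h
        · let _ := S.ord
          exact lt_trans (hsupp β h) (hg N (N + 1) (Nat.lt_succ_self N))
        · rw [Finset.mem_singleton.1 (Finsupp.support_single_subset h)]
          exact hg N (N + 1) (Nat.lt_succ_self N)
  obtain ⟨v, hv, hsupp⟩ := hex
  refine ⟨v, hv, norm_vec_le (by norm_num) fun γ => ?_⟩
  rw [← ev_congr (f := projStar {β | S.ord.lt β (g N)} (S.eStar γ))]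
  · refine ((rep_projStar_eStar γ.2 _ (isInitial_lt _)).abs_ev_le zero_le_one
      fun δ hδ => ?_).trans (by norm_num)
    obtain ⟨i, rfl⟩ := g.surjective δ
    have hi : i < N := by simpa using (lt_enumeration_iff g hg N (g i)).1 hδ
    rw [hv i hi]
    exact hs _
  · intro β hβ
    rw [projStar_apply, if_pos (hsupp β hβ)]

theorem norm_le_dualMap (g : ℕ ≃ C.Gamma)
    (hg : ∀ i k : ℕ, i < k → S.ord.lt (g i : Node) (g k : Node))
    (a : lp (fun _ : C.Gamma => ℝ) 1) : ‖a‖ ≤ 2 * ‖C.dualMap a‖ := by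
  classical
  refine norm_le_of_sum_single C.dualMap (fun a s => ?_) a
  obtain ⟨v, hv, hnorm⟩ := exists_extension g hg (fun γ => (SignType.sign (a γ) : ℝ))
    (fun γ => by rcases lt_trichotomy (a γ) 0 with h | h | h <;> simp [h])
    ((s.sup fun γ => g.symm γ) + 1)
  refine ⟨C.vec v, hnorm, le_of_eq ?_⟩
  rw [map_sum, sum_apply]
  refine Finset.sum_congr rfl fun γ hγ => ?_
  have hlt : g.symm γ < (s.sup fun γ => g.symm γ) + 1 :=
    Nat.lt_succ_of_le (Finset.le_sup (f := fun γ => g.symm γ) hγ)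
  have := hv _ hlt
  rw [Equiv.apply_symm_apply] at this
  rw [dualMap_single, vec_apply, this, self_mul_sign]

end Coding

end Scheme

end Kus

end

theorem mainTheorem6 (S : Kus.Scheme) (C : Kus.Scheme.Coding S) :
    (∃ (g : ℕ ≃ C.Gamma) (b : SchauderBasis ℝ C.XKus),
      (∀ i k : ℕ, i < k → S.ord.lt (g i : Kus.Node) (g k : Kus.Node)) ∧
      (∀ i : ℕ, b i = C.d (g i)) ∧
      Kus.IsShrinking b) ∧
    Nonempty (StrongDual ℝ C.XKus ≃L[ℝ] lp (fun _ : C.Gamma => ℝ) 1) := by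
  obtain ⟨g, hg⟩ := C.exists_increasing_enumeration
  obtain ⟨b, hb, hshrink, hcoord⟩ := C.exists_shrinking_basis g hg
  exact ⟨⟨g, b, hg, hb, hshrink⟩, Kus.nonempty_equiv_dual (K := 2) C.dualMap
    (fun a => Kus.Scheme.Coding.norm_le_dualMap g hg a) hshrink hcoord⟩
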